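/- Let $1<\alpha<3$ and $0<r_1<\infty$. Let $Y\subset\mathbb{R}^2$ be a random compact set such that, for some constants $0<a_1<a_2$, almost surely $D(a_1)\subset Y\subset D(a_2)$ ($D(a)$ is the closed disk of radius $a$ centered at $0$), and such that the boundary of $Y$ almost surely has zero Lebesgue measure. Let $C_0=\{C_0(x):x\in\mathbb{R}^2\}$ be a real-valued random field. For $0<r_0<r_1$ let $I(C_0,r_0,r_1)$ be the following colored dead leaves process. Let $X=RY$, where $R$ is independent of $Y$ and has density $\frac{\alpha-1}{r_0^{1-\alpha}-r_1^{1-\alpha}}\,r^{-\alpha}$ on $[r_0,r_1]$. Let $\{(x_i,t_i)\}$ be a Poisson point process of intensity one on $\mathbb{R}^2\times\mathbb{R}$, let $(X_i)$ be i.i.d. copies of $X$, and let $(C_i)$ be independent copies of the field $C_0$, with $\{(x_i,t_i)\}$, $(X_i)$ and $(C_i)$ independent. For $t_i<0$ let $V_i=(x_i+X_i)\setminus\bigcup_{t_i<t_j<0}(x_j+\mathring X_j)$ (the visible parts). Then $I(C_0,r_0,r_1)(x)=C_i(x)$ if $x\in\mathring V_i$ and $x\notin\bigcup_j\partial V_j$,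 and $I(C_0,r_0,r_1)(x)=0$ if $x\in\bigcup_j\partial V_j$. Let $I(C_0,0,r_1)$ be a random field that is the limit of $I(C_0,r_0,r_1)$ as $r_0\to0^+$ in the sense of finite-dimensional distributions. Assume that $C_0$ is stochastically continuous, i.e. $C_0(y)\to C_0(x)$ in probability as $y\to x$, for every $x\in\mathbb{R}^2$. Then: 1. $I(C_0,0,r_1)$ is stochastically continuous. 2. The following are equivalent: (a) $C_0$ has a jointly measurable modification; (b) $C_0$ has a measurable version, i.e. there is a jointly measurable random field, possibly on another probability space, with the same finite-dimensional distributions; (c) for all Borel sets $G,H\subset\mathbb{R}$ and all $x\in\mathbb{R}^2$, the map $y\mapsto \Pr(C_0(x)\in G,\ C_0(y)\in H)$ is Borel measurable. 3. If moreover these equivalent conditions hold, then $I(C_0,0,r_1)$ has a jointly measurable modification: there is a jointly measurable field $\tilde I$ on the same probability space as $I(C_0,0,r_1)$ such that $\Pr(\tilde I(x)=I(C_0,0,r_1)(x))=1$ for every $x\in\mathbb{R}^2$. -/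

import Mathlib

open MeasureTheory ProbabilityTheory Set Filter Topology TopologicalSpace
open scoped ENNReal NNReal Pointwise

noncomputable section

namespace DeadLeaves

/-- The Euclidean plane. -/
abbrev Plane : Type := EuclideanSpace ℝ (Fin 2)

/-! ### Random compact sets -/

/-- The σ-algebra on the compact subsets of the plane generated by the events `K ∩ G ≠ ∅`, with `G`
open: the trace of the Borel σ-algebra of the Fell (hit-or-miss) topology on closed sets. -/
instance compactsMeasurableSpace : MeasurableSpace (Compacts Plane) :=
  MeasurableSpace.generateFrom
    {A | ∃ G : Set Plane, IsOpen G ∧ A = {K : Compacts Plane | ((K : Set Plane) ∩ G).Nonempty}}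

/-- The homothetic set `r K`. -/
def scale (r : ℝ) (K : Compacts Plane) : Compacts Plane :=
  K.map (fun x => r • x) (continuous_const_smul r)

theorem measurable_scale :
    Measurable (fun p : ℝ × Compacts Plane => scale p.1 p.2) := by
  refine measurable_generateFrom ?_
  rintro _ ⟨G, hG, rfl⟩
  have hW : IsOpen {q : ℝ × Plane | q.1 • q.2 ∈ G} :=
    hG.preimage (continuous_fst.smul continuous_snd)
  have key : (fun p : ℝ × Compacts Plane => scale p.1 p.2) ⁻¹'
      {K : Compacts Plane | ((K : Set Plane) ∩ G).Nonempty} =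
      ⋃ A ∈ countableBasis ℝ, ⋃ B ∈ countableBasis Plane,
        ⋃ (_ : A ×ˢ B ⊆ {q : ℝ × Plane | q.1 • q.2 ∈ G}),
          A ×ˢ {K : Compacts Plane | ((K : Set Plane) ∩ B).Nonempty} := by
    ext ⟨r, K⟩
    simp only [mem_preimage, mem_ofPred_eq, mem_iUnion, mem_prod, exists_prop]
    constructor
    · rintro ⟨_, ⟨x, hx, rfl⟩, hxG⟩
      obtain ⟨_, ⟨A, hA, B, hB, rfl⟩, hm, hs⟩ :=
        ((isBasis_countableBasis ℝ).prod (isBasis_countableBasis Plane)).exists_subset_of_mem_open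
          (show (r, x) ∈ {q : ℝ × Plane | q.1 • q.2 ∈ G} from hxG) hW
      exact ⟨A, hA, B, hB, hs, hm.1, x, hx, hm.2⟩
    · rintro ⟨A, hA, B, hB, hs, hr, x, hx, hxB⟩
      exact ⟨r • x, ⟨x, hx, rfl⟩, hs (mk_mem_prod hr hxB)⟩
  rw [key]
  refine MeasurableSet.biUnion (countable_countableBasis ℝ) fun A hA =>
    MeasurableSet.biUnion (countable_countableBasis Plane) fun B hB =>
      MeasurableSet.iUnion fun _ => ?_
  exact (isOpen_of_mem_countableBasis hA).measurableSet.prod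
    (MeasurableSpace.measurableSet_generateFrom ⟨B, isOpen_of_mem_countableBasis hB, rfl⟩)

/-- The law on `ℝ` with density `η r ^ (-α)` on `[r₀, r₁]`, where `η` is the normalizing constant
`(α - 1) / (r₀ ^ (1 - α) - r₁ ^ (1 - α))`. -/
def sizeLaw (α r₀ r₁ : ℝ) : Measure ℝ :=
  (volume.restrict (Icc r₀ r₁)).withDensity fun r =>
    ENNReal.ofReal ((α - 1) / (r₀ ^ (1 - α) - r₁ ^ (1 - α)) * r ^ (-α))

/-- The law of the grain `X = R Y`, where `R` has law `sizeLaw α r₀ r₁` and is independent of the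
random compact set `Y`, whose law is `μY`. -/
def grainLaw (α r₀ r₁ : ℝ) (μY : Measure (Compacts Plane)) : Measure (Compacts Plane) :=
  ((sizeLaw α r₀ r₁).prod μY).map fun p => scale p.1 p.2

/-! ### Poisson point processes -/

/-- The random points `ξ 0, ξ 1, …` (counted with multiplicity) form a Poisson point process with
intensity measure `Λ`: the numbers of points in disjoint measurable sets `A` of finite intensity are
independent Poisson random variables with means `Λ A`. -/
structure IsPoissonProcess {S Ω : Type*} [MeasurableSpace S] [MeasurableSpace Ω]
    (ξ : ℕ → Ω → S) (Λ : Measure S) (P : Measure Ω) : Prop where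
  measurable : ∀ i, Measurable (ξ i)
  count_law : ∀ (n : ℕ) (A : Fin n → Set S) (k : Fin n → ℕ),
    (∀ j, MeasurableSet (A j)) → (∀ j, Λ (A j) ≠ ∞) → Pairwise (Function.onFun Disjoint A) →
    P {ω | ∀ j, {i | ξ i ω ∈ A j}.encard = (k j : ℕ∞)} =
      ∏ j, poissonMeasure (Λ (A j)).toNNReal {k j}

/-! ### The dead leaves tessellation and its coloring -/

/-- The visible part of the `i`-th leaf. The points are `(xᵢ, tᵢ)`, the grains are `Xᵢ`, and
`Vᵢ = (xᵢ + Xᵢ) \ ⋃_{tᵢ < tⱼ < 0} (xⱼ + interior Xⱼ)`. Only the leaves fallen before time `0` are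
used: if `tᵢ ≥ 0` the `i`-th set is empty. -/
def visiblePart (p : ℕ → Plane × ℝ) (X : ℕ → Compacts Plane) (i : ℕ) : Set Plane :=
  {y | (p i).2 < 0 ∧ y ∈ (p i).1 +ᵥ (X i : Set Plane) ∧
    ∀ j, (p i).2 < (p j).2 → (p j).2 < 0 → y ∉ (p j).1 +ᵥ interior (X j : Set Plane)}

/-- The boundary of a tessellation: the union of the boundaries of its members. -/
def tessBoundary (F : ℕ → Set Plane) : Set Plane := ⋃ i, frontier (F i)

open Classical in
/-- The tessellation `F` colored by the fields `C i`: the value at `y` is `C i y` if `y` is not in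
the boundary of the tessellation and lies in the interior of `F i` (`i` is unique in a tessellation),
and `0` on the boundary. -/
def colored (F : ℕ → Set Plane) (C : ℕ → Plane → ℝ) (y : Plane) : ℝ :=
  if h : y ∉ tessBoundary F ∧ ∃ i, y ∈ interior (F i) then C (Nat.find h.2) y else 0

/-- `Z` is a colored dead leaves process for the grain law `μX` and the color field `C₀`. It is
built from a Poisson process of points `(xᵢ, tᵢ)` with intensity one on `ℝ² × ℝ`, from i.i.d. grains
`Xᵢ` with law `μX`, independent of the points, and from independent copies `Cᵢ` of `C₀`, independent
of the points and of the grains. -/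
def IsColoredDeadLeaves {Ω Ω₀ : Type*} [MeasurableSpace Ω] [MeasurableSpace Ω₀]
    (μX : Measure (Compacts Plane)) (C₀ : Plane → Ω₀ → ℝ) (P₀ : Measure Ω₀)
    (Z : Plane → Ω → ℝ) (P : Measure Ω) : Prop :=
  ∃ (ξ : ℕ → Ω → Plane × ℝ) (X : ℕ → Ω → Compacts Plane) (C : ℕ → Ω → Plane → ℝ),
    IsPoissonProcess ξ volume P ∧
    (∀ i, Measurable (X i)) ∧ (∀ i, HasLaw (X i) μX P) ∧ iIndepFun X P ∧
    (∀ i, Measurable (C i)) ∧ (∀ i, IdentDistrib (C i) (fun ω y => C₀ y ω) P P₀) ∧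
    iIndepFun C P ∧
    IndepFun (fun ω i => ξ i ω) (fun ω i => X i ω) P ∧
    IndepFun (fun ω => (fun i => ξ i ω, fun i => X i ω)) (fun ω i => C i ω) P ∧
    ∀ y ω, Z y ω = colored (visiblePart (fun i => ξ i ω) (fun i => X i ω)) (fun i => C i ω) y

/-! ### Random fields -/

/-- Convergence of random fields in the sense of finite-dimensional distributions. -/
def FidiTendsto {ι Ω : Type*} {Ω' : ι → Type*} [∀ i, MeasurableSpace (Ω' i)] [MeasurableSpace Ω]
    (Z : ∀ i, Plane → Ω' i → ℝ) (l : Filter ι) (I : Plane → Ω → ℝ)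
    (P' : ∀ i, Measure (Ω' i)) [∀ i, IsProbabilityMeasure (P' i)]
    (P : Measure Ω) [IsProbabilityMeasure P] : Prop :=
  ∀ (n : ℕ) (x : Fin n → Plane),
    TendstoInDistribution (fun i ω k => Z i (x k) ω) l (fun ω k => I (x k) ω) P' P

/-- Stochastic continuity: `Z y → Z x` in probability as `y → x`, for every `x`. -/
def StochasticallyContinuous {Ω : Type*} [MeasurableSpace Ω] (Z : Plane → Ω → ℝ)
    (P : Measure Ω) : Prop :=
  ∀ x, TendstoInMeasure P Z (𝓝 x) (Z x)

/-- `Z` has a measurable modification: a jointly measurable process on the same probability space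
with `Z' x = Z x` almost surely, for every `x`. -/
def HasMeasurableModification {Ω : Type*} [MeasurableSpace Ω] (Z : Plane → Ω → ℝ)
    (P : Measure Ω) : Prop :=
  ∃ Z' : Plane → Ω → ℝ, Measurable (fun p : Ω × Plane => Z' p.2 p.1) ∧
    ∀ x, ∀ᵐ ω ∂P, Z' x ω = Z x ω

/-- `Z` has a measurable version: a jointly measurable process, possibly on another probability
space, with the same finite-dimensional distributions. -/
def HasMeasurableVersion.{u} {Ω : Type u} [MeasurableSpace Ω] (Z : Plane → Ω → ℝ)
    (P : Measure Ω) : Prop :=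
  ∃ (Ω' : Type u) (_ : MeasurableSpace Ω') (P' : Measure Ω') (_ : IsProbabilityMeasure P')
    (Z' : Plane → Ω' → ℝ), Measurable (fun p : Ω' × Plane => Z' p.2 p.1) ∧
    ∀ (n : ℕ) (x : Fin n → Plane),
      IdentDistrib (fun ω k => Z' (x k) ω) (fun ω k => Z (x k) ω) P' P

/-- For all Borel sets `G, H` and all `x`, the map `y ↦ P (Z x ∈ G, Z y ∈ H)` is Borel. -/
def HasMeasurableBivariateLaws {Ω : Type*} [MeasurableSpace Ω] (Z : Plane → Ω → ℝ)
    (P : Measure Ω) : Prop :=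
  ∀ G H : Set ℝ, MeasurableSet G → MeasurableSet H → ∀ x : Plane,
    Measurable fun y : Plane => P {ω | Z x ω ∈ G ∧ Z y ω ∈ H}

end DeadLeaves

end

/-!
The three measurability conditions on a field are tied to stochastic continuity by a theorem of Doob:
a stochastically continuous field `Z` on the plane always has a jointly measurable modification. It
is the pointwise limit superior of fields `y ↦ Z (c n (s n y))` in which `y` is replaced by a nearby
point of a countable set, chosen in a Borel way, and Borel–Cantelli gives convergence to `Z y` almost
surely (`StochasticallyContinuous.hasMeasurableModification`). Such a modification is a measurable
version, and Fubini makes its bivariate laws measurable. Hence everything reduces to the stochastic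
continuity of `I`.

For that, `x` and `y` have the same color `C i` as soon as the last leaf fallen before time `0` among
those meeting `{x, y}` contains both points in its interior (`topLeaf`,
`colored_eq_of_mem_topLeaf`). The index `i` depends on the points and grains only, so that on this
event `Z x - Z y` is controlled by a single copy of `C₀` (`measure_dist_colored_gt_le`). Let `η` be
the normalizing constant of the radius law and look at the leaves fallen in a window `[-k / η, 0)`.

* Radii in `[r₁ / 2, r₁]` have probability of order `η`, so the void probability of the Poisson
  process marked by its grains shows that `x` is covered in the window, up to a probability
  `exp (-k c)` with `c > 0` independent of `r₀`.
* The expected number of leaves in the window that meet `{x, y}` without containing both points in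
  their interior is at most `k * mismatchRate (y - x)`, where `mismatchRate` is an integral over all
  radii in `(0, r₁]` against `r ^ (-α)`. It tends to `0` as `y → x` by dominated convergence, because
  the boundary of `Y` is negligible and `r ^ (2 - α)` is integrable at `0`.

The resulting bound on `P (|Z x - Z y| > ε)` is uniform in `r₀`
(`measure_dist_gt_le_of_isColoredDeadLeaves`), passes to `I` by the portmanteau theorem, and is made
small by choosing first `k` large and then `y` close to `x`.
-/

noncomputable section

namespace DeadLeaves

/-! ### Measurable modifications of stochastically continuous fields -/

/-- A stochastically continuous field is a limit, almost surely at each point, of the fields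
`y ↦ Z (c n (s n y))`, where `s n` is Borel and integer-valued. These fields are jointly measurable
because they are piecewise constant in `y` along countably many Borel pieces. -/
theorem StochasticallyContinuous.hasMeasurableModification {Ω : Type*} [MeasurableSpace Ω]
    {P : Measure Ω} {Z : Plane → Ω → ℝ} (hZ : ∀ x, Measurable (Z x))
    (h : StochasticallyContinuous Z P) : HasMeasurableModification Z P := by
  have hsel : ∀ n : ℕ, ∃ (c : ℕ → Plane) (s : Plane → ℕ), Measurable s ∧
      ∀ y, P {ω | (1 / 2 : ℝ) ^ n ≤ dist (Z y ω) (Z (c (s y)) ω)} ≤ (1 / 2 : ℝ≥0∞) ^ n := by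
    intro n
    have hnhds : ∀ x, ∃ U : Set Plane, IsOpen U ∧ x ∈ U ∧ ∀ y ∈ U,
        P {ω | (1 / 2 : ℝ) ^ n ≤ dist (Z y ω) (Z x ω)} ≤ (1 / 2 : ℝ≥0∞) ^ n := by
      intro x
      have hpos : (0 : ℝ≥0∞) < (1 / 2 : ℝ≥0∞) ^ n := ENNReal.pow_pos (by simp) n
      have := (tendstoInMeasure_iff_dist.1 (h x) ((1 / 2 : ℝ) ^ n) (by positivity)).eventually
        (ge_mem_nhds hpos)
      obtain ⟨U, hU, hUo, hxU⟩ := eventually_nhds_iff.1 this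
      exact ⟨U, hUo, hxU, hU⟩
    choose U hUo hxU hU using hnhds
    obtain ⟨T, hT, hTU⟩ := isOpen_iUnion_countable U hUo
    have hcov : ∀ y, ∃ x ∈ T, y ∈ U x := fun y => by
      have : y ∈ ⋃ x ∈ T, U x := hTU ▸ mem_iUnion.2 ⟨y, hxU y⟩
      simpa using this
    have hTne : T.Nonempty := let ⟨x, hx, _⟩ := hcov 0; ⟨x, hx⟩
    obtain ⟨c, rfl⟩ := hT.exists_eq_range hTne
    have hcov' : ∀ y, ∃ k, y ∈ U (c k) := fun y => by simpa using hcov y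
    classical
    refine ⟨c, fun y => Nat.find (hcov' y),
      measurable_find hcov' fun k => (hUo (c k)).measurableSet, fun y => ?_⟩
    exact hU _ y (Nat.find_spec (hcov' y))
  choose c s hs hcs using hsel
  have hjoint : ∀ n, Measurable fun p : Ω × Plane => Z (c n (s n p.2)) p.1 := fun n =>
    (measurable_from_prod_countable_left (f := fun q : Ω × ℕ => Z (c n q.2) q.1)
      fun k => hZ (c n k)).comp (measurable_fst.prodMk ((hs n).comp measurable_snd))
  refine ⟨fun y ω => limsup (fun n => Z (c n (s n y)) ω) atTop, Measurable.limsup hjoint,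
    fun y => ?_⟩
  have hsum : ∑' n, P {ω | (1 / 2 : ℝ) ^ n ≤ dist (Z y ω) (Z (c n (s n y)) ω)} ≠ ∞ := by
    refine ne_top_of_le_ne_top ?_ (ENNReal.tsum_le_tsum fun n => hcs n y)
    rw [ENNReal.tsum_geometric]
    simp
  filter_upwards [ae_eventually_notMem hsum] with ω hω
  refine Tendsto.limsup_eq (tendsto_iff_dist_tendsto_zero.2 ?_)
  refine squeeze_zero' (Eventually.of_forall fun _ => dist_nonneg) ?_
    (tendsto_pow_atTop_nhds_zero_of_lt_one (r := (1 / 2 : ℝ)) (by norm_num) (by norm_num))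
  filter_upwards [hω] with n hn
  rw [dist_comm]
  simpa using (not_le.1 hn).le

theorem HasMeasurableModification.hasMeasurableVersion {Ω : Type*} [MeasurableSpace Ω]
    {P : Measure Ω} [IsProbabilityMeasure P] {Z : Plane → Ω → ℝ} (hZ : ∀ x, Measurable (Z x))
    (h : HasMeasurableModification Z P) : HasMeasurableVersion Z P := by
  obtain ⟨Z', hZ', hae⟩ := h
  refine ⟨Ω, _, P, inferInstance, Z', hZ', fun n x => ?_⟩
  have hm : Measurable fun ω k => Z (x k) ω := measurable_pi_lambda _ fun k => hZ (x k)
  have hm' : Measurable fun ω (k : Fin n) => Z' (x k) ω :=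
    measurable_pi_lambda _ fun k => hZ'.comp measurable_prodMk_right
  refine ⟨hm'.aemeasurable, hm.aemeasurable, Measure.map_congr ?_⟩
  filter_upwards [ae_all_iff.2 fun k => hae (x k)] with ω hω
  exact funext hω

theorem HasMeasurableModification.hasMeasurableBivariateLaws {Ω : Type*} [MeasurableSpace Ω]
    {P : Measure Ω} [IsProbabilityMeasure P] {Z : Plane → Ω → ℝ} (hZ : ∀ x, Measurable (Z x))
    (h : HasMeasurableModification Z P) : HasMeasurableBivariateLaws Z P := by
  obtain ⟨Z', hZ', hae⟩ := h
  intro G H hG hH x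
  have hS : MeasurableSet {p : Ω × Plane | Z x p.1 ∈ G ∧ Z' p.2 p.1 ∈ H} :=
    (((hZ x).comp measurable_fst) hG).inter (hZ' hH)
  convert! measurable_measure_prodMk_right (μ := P) hS using 2 with y
  refine measure_congr ?_
  filter_upwards [hae y] with ω hω
  simp only [eq_iff_iff]
  change (Z x ω ∈ G ∧ Z y ω ∈ H) ↔ (Z x ω ∈ G ∧ Z' y ω ∈ H)
  rw [hω]

/-! ### Poisson processes with independent marks -/

/-- The generating function of the Poisson law. -/
theorem lintegral_pow_poissonMeasure (r q : ℝ≥0) :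
    ∫⁻ k : ℕ, (q : ℝ≥0∞) ^ k ∂poissonMeasure r = ENNReal.ofReal (Real.exp (-r * (1 - q))) := by
  have hs : HasSum (fun k : ℕ => Real.exp (-r) * ((r * q : ℝ) ^ k / (k.factorial : ℝ)))
      (Real.exp (-r) * Real.exp (r * q)) := by
    have := (NormedSpace.expSeries_div_hasSum_exp (r * q : ℝ)).mul_left (Real.exp (-r))
    rwa [← Real.exp_eq_exp_ℝ] at this
  rw [lintegral_countable', show -(r : ℝ) * (1 - q) = -r + r * q by ring, Real.exp_add,
    ← hs.tsum_eq, ENNReal.ofReal_tsum_of_nonneg (fun k => by positivity) hs.summable]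
  refine tsum_congr fun k => ?_
  rw [poissonMeasure_singleton, ← ENNReal.ofReal_coe_nnreal, ← ENNReal.ofReal_pow q.coe_nonneg,
    ← ENNReal.ofReal_mul (by positivity)]
  congr 1
  rw [mul_pow]
  ring

/-- The mean of the Poisson law. -/
theorem lintegral_id_poissonMeasure (r : ℝ≥0) :
    ∫⁻ k : ℕ, (k : ℝ≥0∞) ∂poissonMeasure r = r := by
  have hs : HasSum (fun k : ℕ => Real.exp (-r) * (r * ((r : ℝ) ^ k / (k.factorial : ℝ))))
      (Real.exp (-r) * (r * Real.exp r)) := by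
    have := ((NormedSpace.expSeries_div_hasSum_exp (r : ℝ)).mul_left (r : ℝ)).mul_left
      (Real.exp (-r))
    rwa [← Real.exp_eq_exp_ℝ] at this
  have hval : Real.exp (-r) * (r * Real.exp r) = r := by
    rw [mul_left_comm, ← Real.exp_add]; simp
  rw [hval] at hs
  rw [lintegral_countable', tsum_eq_zero_add' ENNReal.summable, Nat.cast_zero, zero_mul, zero_add,
    ← ENNReal.ofReal_coe_nnreal, ← hs.tsum_eq,
    ENNReal.ofReal_tsum_of_nonneg (fun k => by positivity) hs.summable]
  refine tsum_congr fun k => ?_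
  rw [poissonMeasure_singleton, ← ENNReal.ofReal_natCast, ← ENNReal.ofReal_mul (by positivity)]
  congr 1
  rw [Nat.factorial_succ]
  push_cast
  field_simp
  ring

theorem encard_preimage_eq_tsum {S Ω : Type*} (ξ : ℕ → Ω → S) (A : Set S) (ω : Ω) :
    (({i | ξ i ω ∈ A}.encard : ℕ∞) : ℝ≥0∞) = ∑' i, (ξ i ⁻¹' A).indicator (1 : Ω → ℝ≥0∞) ω := by
  rw [← ENNReal.tsum_set_one, tsum_subtype {i | ξ i ω ∈ A} fun _ => (1 : ℝ≥0∞)]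
  rfl

namespace IsPoissonProcess

variable {S Ω : Type*} [MeasurableSpace S] [MeasurableSpace Ω] {ξ : ℕ → Ω → S} {Λ : Measure S}
  {P : Measure Ω} {A : Set S}

theorem measure_encard_eq (h : IsPoissonProcess ξ Λ P) (hA : MeasurableSet A) (hΛ : Λ A ≠ ∞)
    (k : ℕ) : P {ω | {i | ξ i ω ∈ A}.encard = k} = poissonMeasure (Λ A).toNNReal {k} := by
  have := h.count_law 1 (fun _ => A) (fun _ => k) (fun _ => hA) (fun _ => hΛ)
    (fun i j hij => (hij (Subsingleton.elim i j)).elim)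
  simpa using this

theorem measurableSet_encard_eq (h : IsPoissonProcess ξ Λ P) (hA : MeasurableSet A) (k : ℕ) :
    MeasurableSet {ω | {i | ξ i ω ∈ A}.encard = k} := by
  have hm : Measurable fun ω => (({i | ξ i ω ∈ A}.encard : ℕ∞) : ℝ≥0∞) := by
    simp_rw [encard_preimage_eq_tsum]
    exact Measurable.tsum fun i => measurable_one.indicator (h.measurable i hA)
  convert! hm (measurableSet_singleton (k : ℝ≥0∞)) using 1
  ext ω
  simp only [mem_ofPred_eq, mem_preimage, mem_singleton_iff]
  rw [← ENat.toENNReal_coe, ENat.toENNReal_inj]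

/-- The Poisson weights on `ℕ` sum to one, which leaves no mass for an infinite count. -/
theorem ae_finite [IsProbabilityMeasure P] (h : IsPoissonProcess ξ Λ P) (hA : MeasurableSet A)
    (hΛ : Λ A ≠ ∞) : ∀ᵐ ω ∂P, {i | ξ i ω ∈ A}.Finite := by
  have hm : MeasurableSet (⋃ k : ℕ, {ω | {i | ξ i ω ∈ A}.encard = k}) :=
    MeasurableSet.iUnion (h.measurableSet_encard_eq hA)
  have hone : P (⋃ k : ℕ, {ω | {i | ξ i ω ∈ A}.encard = k}) = 1 := by
    rw [measure_iUnion (fun k l hkl => disjoint_left.2 fun ω h₁ h₂ => hkl ?_)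
      (h.measurableSet_encard_eq hA)]
    · simp_rw [h.measure_encard_eq hA hΛ]
      rw [← measure_iUnion (fun k l hkl => by simpa using hkl) (fun k => measurableSet_singleton k),
        iUnion_of_singleton, measure_univ]
    · exact Nat.cast_injective (R := ℕ∞) (h₁.symm.trans h₂)
  filter_upwards [(prob_compl_eq_zero_iff hm).2 hone |> compl_mem_ae_iff.2] with ω hω
  rw [compl_compl] at hω
  obtain ⟨k, hk⟩ := mem_iUnion.1 hω
  exact finite_of_encard_eq_coe hk

/-- Expectations under the Poisson law of the count `N(A)`. The value `g ⊤` is irrelevant, since the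
count is almost surely finite. -/
theorem lintegral_encard [IsProbabilityMeasure P] (h : IsPoissonProcess ξ Λ P)
    (hA : MeasurableSet A) (hΛ : Λ A ≠ ∞) (g : ℕ∞ → ℝ≥0∞) :
    ∫⁻ ω, g {i | ξ i ω ∈ A}.encard ∂P = ∫⁻ k : ℕ, g k ∂poissonMeasure (Λ A).toNNReal := by
  have hU : (⋃ k : ℕ, {ω | {i | ξ i ω ∈ A}.encard = k}) =ᵐ[P] univ := by
    refine eventuallyEq_univ.2 ?_
    filter_upwards [h.ae_finite hA hΛ] with ω hω
    exact mem_iUnion.2 ⟨hω.toFinset.card, hω.encard_eq_coe_toFinset_card⟩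
  rw [lintegral_countable' (μ := poissonMeasure _), ← setLIntegral_univ fun ω => g _, ← setLIntegral_congr hU,
    lintegral_iUnion (h.measurableSet_encard_eq hA)
      (fun k l hkl => disjoint_left.2 fun ω h₁ h₂ => hkl
        (Nat.cast_injective (R := ℕ∞) (Eq.trans (Eq.symm h₁) h₂)))]
  refine tsum_congr fun k => ?_
  rw [setLIntegral_congr_fun (h.measurableSet_encard_eq hA k)
    (g := fun _ => g k) (fun ω hω => by simp only [mem_ofPred_eq] at hω; simp only [hω]),
    setLIntegral_const, h.measure_encard_eq hA hΛ]

/-- The intensity measure is the mean measure of the process. -/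
theorem sum_map_eq [IsProbabilityMeasure P] [SigmaFinite Λ] (h : IsPoissonProcess ξ Λ P) :
    Measure.sum (fun i => P.map (ξ i)) = Λ := by
  have hfin : ∀ A, MeasurableSet A → Λ A ≠ ∞ → Measure.sum (fun i => P.map (ξ i)) A = Λ A := by
    intro A hA hΛ
    rw [Measure.sum_apply _ hA]
    have := h.lintegral_encard hA hΛ fun n => (n : ℝ≥0∞)
    simp_rw [encard_preimage_eq_tsum, ENat.toENNReal_coe, lintegral_id_poissonMeasure,
      ENNReal.coe_toNNReal hΛ] at this
    rw [← this, lintegral_tsum fun i =>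
      (measurable_one.indicator (h.measurable i hA)).aemeasurable]
    refine tsum_congr fun i => ?_
    rw [Measure.map_apply (h.measurable i) hA, lintegral_indicator_one (h.measurable i hA)]
  refine (Measure.ext_iff_of_iUnion_eq_univ (iUnion_spanningSets Λ)).2 fun n => ?_
  ext A hA
  rw [Measure.restrict_apply hA, Measure.restrict_apply hA]
  exact hfin _ (hA.inter (measurableSet_spanningSets Λ n))
    (ne_top_of_le_ne_top (measure_spanningSets_lt_top Λ n).ne (measure_mono inter_subset_right))

variable {M : Type*} [MeasurableSpace M] {X : ℕ → Ω → M} {μ : Measure M}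

/-- First-moment bound for the marked process `(ξ i, X i)`. -/
theorem measure_exists_mem_le [IsProbabilityMeasure P] [SigmaFinite Λ]
    (h : IsPoissonProcess ξ Λ P) (hX : ∀ i, Measurable (X i)) (hlaw : ∀ i, HasLaw (X i) μ P)
    (hind : IndepFun (fun ω i => ξ i ω) (fun ω i => X i ω) P) {W : Set (S × M)}
    (hW : MeasurableSet W) : P {ω | ∃ i, (ξ i ω, X i ω) ∈ W} ≤ (Λ.prod μ) W := by
  have : IsProbabilityMeasure μ := (hlaw 0).map_eq ▸
    Measure.isProbabilityMeasure_map (hX 0).aemeasurable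
  rw [ofPred_exists]
  refine (measure_iUnion_le _).trans ?_
  rw [← h.sum_map_eq, Measure.prod_sum_left, Measure.sum_apply _ hW]
  refine ENNReal.tsum_le_tsum fun i => le_of_eq ?_
  have hi : IndepFun (ξ i) (X i) P :=
    hind.comp (measurable_pi_apply i) (measurable_pi_apply i)
  have hmap := (indepFun_iff_map_prod_eq_prod_map_map (h.measurable i).aemeasurable
    (hX i).aemeasurable).1 hi
  rw [(hlaw i).map_eq] at hmap
  rw [← hmap, Measure.map_apply ((h.measurable i).prodMk (hX i)) hW]
  rfl

/-- Void probability of the marked process `(ξ i, X i)` on a rectangle `A × B`: given the points, the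
`N(A)` marks of those in `A` all avoid `B` with probability `(1 - μ B) ^ N(A)`, and the generating
function of the Poisson variable `N(A)` gives the bound. -/
theorem measure_forall_notMem_le [IsProbabilityMeasure P]
    (h : IsPoissonProcess ξ Λ P) (hX : ∀ i, Measurable (X i)) (hlaw : ∀ i, HasLaw (X i) μ P)
    (hXind : iIndepFun X P) (hind : IndepFun (fun ω i => ξ i ω) (fun ω i => X i ω) P)
    (hA : MeasurableSet A) (hΛ : Λ A ≠ ∞) {B : Set M} (hB : MeasurableSet B) :
    P {ω | ∀ i, ξ i ω ∈ A → X i ω ∉ B} ≤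
      ENNReal.ofReal (Real.exp (-((Λ A).toReal * μ.real B))) := by
  have hμ : IsProbabilityMeasure μ := (hlaw 0).map_eq ▸
    Measure.isProbabilityMeasure_map (hX 0).aemeasurable
  have hξm : Measurable fun ω i => ξ i ω := measurable_pi_lambda _ h.measurable
  have hXm : Measurable fun ω i => X i ω := measurable_pi_lambda _ hX
  have hW : MeasurableSet {p : (ℕ → S) × (ℕ → M) | ∀ i, p.1 i ∈ A → p.2 i ∉ B} := by
    rw [ofPred_forall]
    refine MeasurableSet.iInter fun i => ?_
    have h₁ : MeasurableSet {p : (ℕ → S) × (ℕ → M) | p.1 i ∈ A} :=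
      ((measurable_pi_apply i).comp measurable_fst) hA
    have h₂ : MeasurableSet {p : (ℕ → S) × (ℕ → M) | p.2 i ∈ B} :=
      ((measurable_pi_apply i).comp measurable_snd) hB
    convert! h₁.compl.union h₂.compl using 1
    ext p
    simp [imp_iff_not_or]
  have hmap := (indepFun_iff_map_prod_eq_prod_map_map hξm.aemeasurable hXm.aemeasurable).1 hind
  have hprob : IsProbabilityMeasure (P.map fun ω i => X i ω) :=
    Measure.isProbabilityMeasure_map hXm.aemeasurable
  -- For fixed points, the marks of those in `A` are finitely many independent copies.
  have hsec : ∀ (s : ℕ → S), {i | s i ∈ A}.Finite →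
      (P.map fun ω i => X i ω) (Prod.mk s ⁻¹' {p | ∀ i, p.1 i ∈ A → p.2 i ∉ B}) ≤
        ((μ Bᶜ).toNNReal : ℝ≥0∞) ^ ({i | s i ∈ A}.encard.toNat) := by
    intro s hs
    rw [Measure.map_apply hXm (measurable_prodMk_left hW), hs.encard_eq_coe_toFinset_card,
      ENat.toNat_natCast, ENNReal.coe_toNNReal (measure_ne_top μ _)]
    have := hXind.measure_inter_preimage_eq_mul hs.toFinset (sets := fun _ => Bᶜ)
      fun i _ => hB.compl
    have hi : ∀ i, P (X i ⁻¹' Bᶜ) = μ Bᶜ := fun i => by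
      rw [← (hlaw i).map_eq, Measure.map_apply (hX i) hB.compl]
    simp_rw [hi, Finset.prod_const] at this
    rw [← this]
    refine measure_mono fun ω hω => ?_
    simp only [Finite.mem_toFinset, mem_ofPred_eq, mem_iInter, mem_preimage, mem_compl_iff] at hω ⊢
    exact hω
  calc P {ω | ∀ i, ξ i ω ∈ A → X i ω ∉ B}
      = (P.map fun ω => (fun i => ξ i ω, fun i => X i ω))
          {p : (ℕ → S) × (ℕ → M) | ∀ i, p.1 i ∈ A → p.2 i ∉ B} := by
        rw [Measure.map_apply (hξm.prodMk hXm) hW]; rfl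
    _ = ∫⁻ ω, (P.map fun ω i => X i ω)
          (Prod.mk (fun i => ξ i ω) ⁻¹' {p | ∀ i, p.1 i ∈ A → p.2 i ∉ B}) ∂P := by
        rw [hmap, Measure.prod_apply hW, lintegral_map (measurable_measure_prodMk_left hW) hξm]
    _ ≤ ∫⁻ ω, ((μ Bᶜ).toNNReal : ℝ≥0∞) ^ ({i | ξ i ω ∈ A}.encard.toNat) ∂P := by
        refine lintegral_mono_ae ?_
        filter_upwards [h.ae_finite hA hΛ] with ω hω
        exact hsec _ hω
    _ = ENNReal.ofReal (Real.exp (-((Λ A).toReal * μ.real B))) := by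
        rw [h.lintegral_encard hA hΛ fun n => ((μ Bᶜ).toNNReal : ℝ≥0∞) ^ n.toNat]
        simp only [ENat.toNat_natCast]
        rw [lintegral_pow_poissonMeasure]
        congr 2
        have : ((μ Bᶜ).toNNReal : ℝ) = 1 - μ.real B := probReal_compl_eq_one_sub hB
        rw [this, sub_sub_cancel, neg_mul]
        rfl

end IsPoissonProcess

/-! ### Covering events -/

theorem measurableSet_inter_nonempty {G : Set Plane} (hG : IsOpen G) :
    MeasurableSet {K : Compacts Plane | ((K : Set Plane) ∩ G).Nonempty} :=
  MeasurableSpace.measurableSet_generateFrom ⟨G, hG, rfl⟩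

theorem measurableSet_subset_of_isClosed {F : Set Plane} (hF : IsClosed F) :
    MeasurableSet {K : Compacts Plane | (K : Set Plane) ⊆ F} := by
  convert! (measurableSet_inter_nonempty hF.isOpen_compl).compl using 1
  ext K
  simp only [mem_ofPred_eq, mem_compl_iff, not_nonempty_iff_eq_empty, ← disjoint_iff_inter_eq_empty,
    disjoint_compl_right_iff_subset]

theorem measurableSet_mem :
    MeasurableSet {q : Plane × Compacts Plane | q.1 ∈ (q.2 : Set Plane)} := by
  have key : {q : Plane × Compacts Plane | q.1 ∈ (q.2 : Set Plane)}ᶜ =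
      ⋃ B ∈ countableBasis Plane,
        B ×ˢ {K : Compacts Plane | ((K : Set Plane) ∩ B).Nonempty}ᶜ := by
    ext ⟨v, K⟩
    simp only [mem_compl_iff, mem_ofPred_eq, mem_iUnion, mem_prod, exists_prop,
      not_nonempty_iff_eq_empty, ← disjoint_iff_inter_eq_empty]
    constructor
    · intro hv
      obtain ⟨B, hB, hvB, hBK⟩ := (isBasis_countableBasis Plane).exists_subset_of_mem_open
        (show v ∈ (K : Set Plane)ᶜ from hv) K.isCompact.isClosed.isOpen_compl
      exact ⟨B, hB, hvB, (subset_compl_iff_disjoint_left.1 hBK)⟩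
    · rintro ⟨B, hB, hvB, hd⟩ hv
      exact disjoint_left.1 hd hv hvB
  rw [← compl_compl {q : Plane × Compacts Plane | q.1 ∈ (q.2 : Set Plane)}, key]
  refine (MeasurableSet.biUnion (countable_countableBasis Plane) fun B hB => ?_).compl
  have hBo := isOpen_of_mem_countableBasis hB
  exact hBo.measurableSet.prod (measurableSet_inter_nonempty hBo).compl

theorem measurableSet_superset_of_isOpen {B : Set Plane} (hB : IsOpen B) :
    MeasurableSet {K : Compacts Plane | B ⊆ K} := by
  have key : {K : Compacts Plane | B ⊆ K} =
      ⋂ q ∈ denseSeq Plane '' (denseSeq Plane ⁻¹' B), {K : Compacts Plane | q ∈ (K : Set Plane)} := by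
    ext K
    simp only [mem_ofPred_eq, mem_iInter]
    constructor
    · rintro h _ ⟨n, hn, rfl⟩
      exact h hn
    · intro h
      rw [image_preimage_eq_inter_range] at h
      refine ((denseRange_denseSeq Plane).open_subset_closure_inter hB).trans ?_
      exact closure_minimal h K.isCompact.isClosed
  rw [key]
  refine MeasurableSet.biInter ((to_countable _).image _) fun q _ => ?_
  exact (measurable_prodMk_left : Measurable (Prod.mk q)) measurableSet_mem

theorem measurableSet_mem_interior :
    MeasurableSet {q : Plane × Compacts Plane | q.1 ∈ interior (q.2 : Set Plane)} := by
  have key : {q : Plane × Compacts Plane | q.1 ∈ interior (q.2 : Set Plane)} =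
      ⋃ B ∈ countableBasis Plane, B ×ˢ {K : Compacts Plane | B ⊆ K} := by
    ext ⟨v, K⟩
    simp only [mem_ofPred_eq, mem_iUnion, mem_prod, exists_prop]
    constructor
    · intro hv
      obtain ⟨B, hB, hvB, hBK⟩ :=
        (isBasis_countableBasis Plane).exists_subset_of_mem_open hv isOpen_interior
      exact ⟨B, hB, hvB, hBK.trans interior_subset⟩
    · rintro ⟨B, hB, hvB, hBK⟩
      exact interior_maximal hBK (isOpen_of_mem_countableBasis hB) hvB
  rw [key]
  refine MeasurableSet.biUnion (countable_countableBasis Plane) fun B hB => ?_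
  have hBo := isOpen_of_mem_countableBasis hB
  exact hBo.measurableSet.prod (measurableSet_superset_of_isOpen hBo)

/-- The leaves `((u, t), K)` that meet `{x, y}`. -/
def touching (x y : Plane) : Set ((Plane × ℝ) × Compacts Plane) :=
  {q | x ∈ q.1.1 +ᵥ (q.2 : Set Plane) ∨ y ∈ q.1.1 +ᵥ (q.2 : Set Plane)}

/-- The leaves `((u, t), K)` that contain `{x, y}` in their interior. -/
def engulfing (x y : Plane) : Set ((Plane × ℝ) × Compacts Plane) :=
  {q | x ∈ q.1.1 +ᵥ interior (q.2 : Set Plane) ∧ y ∈ q.1.1 +ᵥ interior (q.2 : Set Plane)}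

theorem mem_vadd_iff_sub_mem {x u : Plane} {S : Set Plane} : x ∈ u +ᵥ S ↔ x - u ∈ S := by
  rw [mem_vadd_set_iff_neg_vadd_mem, vadd_eq_add, neg_add_eq_sub]

theorem measurable_sub_position (x : Plane) :
    Measurable fun q : (Plane × ℝ) × Compacts Plane => (x - q.1.1, q.2) :=
  (measurable_const.sub (measurable_fst.comp measurable_fst)).prodMk measurable_snd

theorem measurableSet_touching (x y : Plane) : MeasurableSet (touching x y) := by
  simp only [touching, mem_vadd_iff_sub_mem]
  exact (measurable_sub_position x measurableSet_mem).union
    (measurable_sub_position y measurableSet_mem)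

theorem measurableSet_engulfing (x y : Plane) : MeasurableSet (engulfing x y) := by
  simp only [engulfing, mem_vadd_iff_sub_mem]
  exact (measurable_sub_position x measurableSet_mem_interior).inter
    (measurable_sub_position y measurableSet_mem_interior)

theorem engulfing_subset_touching (x y : Plane) : engulfing x y ⊆ touching x y :=
  fun _ hq => Or.inl (vadd_set_mono interior_subset hq.1)

/-- The configurations of points and grains in which the leaf `i` is the last one fallen before
time `0` among those meeting `{x, y}`, and contains both `x` and `y` in its interior. Leaves falling
at the same time are allowed, provided that all of them contain both points in their interior; `i` is
then the least of their indices. -/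
def topLeaf (x y : Plane) (i : ℕ) : Set ((ℕ → Plane × ℝ) × (ℕ → Compacts Plane)) :=
  {q | (q.1 i).2 < 0 ∧ (q.1 i, q.2 i) ∈ engulfing x y ∧
    ∀ j, (q.1 j).2 < 0 → (q.1 j, q.2 j) ∈ touching x y → (q.1 j).2 < (q.1 i).2 ∨
      ((q.1 j).2 = (q.1 i).2 ∧ (q.1 j, q.2 j) ∈ engulfing x y ∧ i ≤ j)}

theorem measurableSet_topLeaf (x y : Plane) (i : ℕ) : MeasurableSet (topLeaf x y i) := by
  have hp : ∀ j, Measurable fun q : (ℕ → Plane × ℝ) × (ℕ → Compacts Plane) => (q.1 j, q.2 j) :=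
    fun j => ((measurable_pi_apply j).comp measurable_fst).prodMk
      ((measurable_pi_apply j).comp measurable_snd)
  have ht : ∀ j, Measurable fun q : (ℕ → Plane × ℝ) × (ℕ → Compacts Plane) => (q.1 j).2 :=
    fun j => measurable_snd.comp ((measurable_pi_apply j).comp measurable_fst)
  have hneg : ∀ j, MeasurableSet {q : (ℕ → Plane × ℝ) × (ℕ → Compacts Plane) | (q.1 j).2 < 0} :=
    fun j => measurableSet_lt (ht j) measurable_const
  have hE : ∀ j, MeasurableSet {q : (ℕ → Plane × ℝ) × (ℕ → Compacts Plane) |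
      (q.1 j, q.2 j) ∈ engulfing x y} := fun j => hp j (measurableSet_engulfing x y)
  have hT : ∀ j, MeasurableSet {q : (ℕ → Plane × ℝ) × (ℕ → Compacts Plane) |
      (q.1 j, q.2 j) ∈ touching x y} := fun j => hp j (measurableSet_touching x y)
  have hj : ∀ j, MeasurableSet {q : (ℕ → Plane × ℝ) × (ℕ → Compacts Plane) |
      (q.1 j).2 < 0 → (q.1 j, q.2 j) ∈ touching x y → (q.1 j).2 < (q.1 i).2 ∨
        ((q.1 j).2 = (q.1 i).2 ∧ (q.1 j, q.2 j) ∈ engulfing x y ∧ i ≤ j)} := fun j =>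
    (hneg j).imp ((hT j).imp ((measurableSet_lt (ht j) (ht i)).union
      ((measurableSet_eq_fun (ht j) (ht i)).inter ((hE j).inter (MeasurableSet.const _)))))
  have hall := MeasurableSet.iInter hj
  rw [← ofPred_forall] at hall
  exact (hneg i).inter ((hE i).inter hall)

theorem pairwise_disjoint_topLeaf (x y : Plane) :
    Pairwise (Function.onFun Disjoint (topLeaf x y)) := by
  intro i j hij
  refine disjoint_left.2 fun q hi hj => hij ?_
  have h₁ := hi.2.2 j hj.1 (engulfing_subset_touching x y hj.2.1)
  have h₂ := hj.2.2 i hi.1 (engulfing_subset_touching x y hi.2.1)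
  rcases h₁ with h₁ | ⟨h₁, -, h₁'⟩ <;> rcases h₂ with h₂ | ⟨h₂, -, h₂'⟩
  · exact absurd h₁ h₂.not_gt
  · exact absurd h₂ h₁.ne'
  · exact absurd h₁ h₂.ne'
  · exact le_antisymm h₁' h₂'

/-! ### Locally finite configurations -/

/-- The grains lie in a common disk and finitely many points fall in each bounded region before time
`0`. -/
def TameConfig (a : ℝ) (p : ℕ → Plane × ℝ) (X : ℕ → Compacts Plane) : Prop :=
  (∀ j, (X j : Set Plane) ⊆ Metric.closedBall 0 a) ∧
    ∀ n : ℕ, {j | p j ∈ Metric.closedBall (0 : Plane) n ×ˢ Icc (-n : ℝ) 0}.Finite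

theorem TameConfig.finite_meeting {a : ℝ} {p : ℕ → Plane × ℝ} {X : ℕ → Compacts Plane}
    (h : TameConfig a p X) (r t : ℝ) :
    {j | t ≤ (p j).2 ∧ (p j).2 < 0 ∧
      ∃ y ∈ (p j).1 +ᵥ (X j : Set Plane), ‖y‖ ≤ r}.Finite := by
  obtain ⟨n, hn⟩ := exists_nat_ge (max (r + a) (-t))
  refine (h.2 n).subset ?_
  rintro j ⟨ht, ht₀, y, hy, hyr⟩
  have hya : ‖y - (p j).1‖ ≤ a := by
    simpa using h.1 j (mem_vadd_iff_sub_mem.1 hy)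
  have h₁ : ‖(p j).1‖ ≤ r + a := by
    calc ‖(p j).1‖ = ‖y - (y - (p j).1)‖ := by rw [sub_sub_cancel]
      _ ≤ ‖y‖ + ‖y - (p j).1‖ := norm_sub_le _ _
      _ ≤ r + a := add_le_add hyr hya
  refine mk_mem_prod (by simpa using h₁.trans ((le_max_left _ _).trans hn)) ⟨?_, ht₀.le⟩
  linarith [(le_max_right (r + a) (-t)).trans hn]

/-- Leaves are closed, so a point that avoids all leaves of a time window has a neighborhood that
does. -/
theorem TameConfig.eventually_notMem {a : ℝ} {p : ℕ → Plane × ℝ} {X : ℕ → Compacts Plane}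
    (h : TameConfig a p X) {x : Plane} {t : ℝ}
    (hx : ∀ j, t < (p j).2 → (p j).2 < 0 → x ∉ (p j).1 +ᵥ (X j : Set Plane)) :
    ∀ᶠ y in 𝓝 x, ∀ j, t < (p j).2 → (p j).2 < 0 → y ∉ (p j).1 +ᵥ (X j : Set Plane) := by
  have hev : ∀ᶠ y in 𝓝 x, ∀ j ∈ {j | t ≤ (p j).2 ∧ (p j).2 < 0 ∧
      ∃ y ∈ (p j).1 +ᵥ (X j : Set Plane), ‖y‖ ≤ ‖x‖ + 1},
      t < (p j).2 → (p j).2 < 0 → y ∉ (p j).1 +ᵥ (X j : Set Plane) := by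
    refine (eventually_all_finite (h.finite_meeting (‖x‖ + 1) t)).2 fun j _ => ?_
    by_cases hj : t < (p j).2 ∧ (p j).2 < 0
    · filter_upwards [((X j).isCompact.isClosed.vadd (p j).1).isOpen_compl.mem_nhds
        (hx j hj.1 hj.2)] with y hy _ _
      exact hy
    · exact Eventually.of_forall fun y h₁ h₂ => absurd ⟨h₁, h₂⟩ hj
  filter_upwards [hev, Metric.ball_mem_nhds x one_pos] with y hy hyx j h₁ h₂ hmem
  refine hy j ⟨h₁.le, h₂, y, hmem, ?_⟩ h₁ h₂ hmem
  have := norm_le_norm_add_norm_sub' y x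
  rw [← dist_eq_norm] at this
  linarith [Metric.mem_ball.1 hyx]

/-! ### The color at a point -/

theorem colored_visiblePart_eq {p : ℕ → Plane × ℝ} {X : ℕ → Compacts Plane}
    (C : ℕ → Plane → ℝ) {x : Plane} {i : ℕ} (hi : (p i).2 < 0)
    (hxi : x ∈ (p i).1 +ᵥ interior (X i : Set Plane))
    (htop : ∀ j, (p j).2 < 0 → x ∈ (p j).1 +ᵥ (X j : Set Plane) → (p j).2 < (p i).2 ∨
      ((p j).2 = (p i).2 ∧ x ∈ (p j).1 +ᵥ interior (X j : Set Plane) ∧ i ≤ j))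
    (hfin : ∀ᶠ y in 𝓝 x, ∀ j, (p i).2 < (p j).2 → (p j).2 < 0 →
      y ∉ (p j).1 +ᵥ (X j : Set Plane)) :
    colored (visiblePart p X) C x = C i x := by
  have hopen : ∀ j, IsOpen ((p j).1 +ᵥ interior (X j : Set Plane)) := fun j =>
    isOpen_interior.vadd _
  have hint : ∀ j, (p j).2 = (p i).2 → x ∈ (p j).1 +ᵥ interior (X j : Set Plane) →
      x ∈ interior (visiblePart p X j) := by
    intro j hj hxj
    refine mem_interior_iff_mem_nhds.2 ?_
    filter_upwards [hfin, (hopen j).mem_nhds hxj] with y hy hyj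
    exact ⟨hj ▸ hi, vadd_set_mono interior_subset hyj, fun k h₁ h₂ hk =>
      hy k (hj ▸ h₁) h₂ (vadd_set_mono interior_subset hk)⟩
  -- A leaf that does not come last at `x` is hidden near `x`, or does not meet a neighborhood of `x`.
  have hcl : ∀ j, x ∈ closure (visiblePart p X j) →
      (p j).2 = (p i).2 ∧ x ∈ (p j).1 +ᵥ interior (X j : Set Plane) ∧ i ≤ j := by
    intro j hj
    have hj₀ : (p j).2 < 0 := by
      obtain ⟨y, hy⟩ := closure_nonempty_iff.1 ⟨x, hj⟩
      exact hy.1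
    have hxj : x ∈ (p j).1 +ᵥ (X j : Set Plane) := by
      have hc : IsClosed ((p j).1 +ᵥ (X j : Set Plane)) := (X j).isCompact.isClosed.vadd _
      exact closure_minimal (fun y hy => hy.2.1) hc hj
    refine (htop j hj₀ hxj).resolve_left fun hlt => ?_
    obtain ⟨y, hyi, hyj⟩ := mem_closure_iff.1 hj _ (hopen i) hxi
    exact hyj.2.2 i hlt hi hyi
  have hb : x ∉ tessBoundary (visiblePart p X) := by
    intro hb
    obtain ⟨j, hj⟩ := mem_iUnion.1 hb
    obtain ⟨h₁, h₂, -⟩ := hcl j hj.1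
    exact hj.2 (hint j h₁ h₂)
  have hex : x ∉ tessBoundary (visiblePart p X) ∧ ∃ j, x ∈ interior (visiblePart p X j) :=
    ⟨hb, i, hint i rfl hxi⟩
  classical
  rw [colored, dif_pos hex]
  congr 1
  refine (Nat.find_eq_iff _).2 ⟨hint i rfl hxi, fun j hj hjx => ?_⟩
  exact hj.not_ge (hcl j (subset_closure (interior_subset hjx))).2.2

/-- Under `topLeaf x y i`, both `x` and `y` receive the color of the leaf `i`. -/
theorem colored_eq_of_mem_topLeaf {a : ℝ} {p : ℕ → Plane × ℝ} {X : ℕ → Compacts Plane}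
    (h : TameConfig a p X) (C : ℕ → Plane → ℝ) {x y : Plane} {i : ℕ}
    (hi : (p, X) ∈ topLeaf x y i) :
    colored (visiblePart p X) C x = C i x ∧ colored (visiblePart p X) C y = C i y := by
  obtain ⟨hi₀, ⟨hxi, hyi⟩, htop⟩ := hi
  refine ⟨colored_visiblePart_eq C hi₀ hxi (fun j hj hxj => ?_)
      (h.eventually_notMem fun j h₁ h₂ hmem => ?_),
    colored_visiblePart_eq C hi₀ hyi (fun j hj hyj => ?_)
      (h.eventually_notMem fun j h₁ h₂ hmem => ?_)⟩
  · exact (htop j hj (Or.inl hxj)).imp_right fun h => ⟨h.1, h.2.1.1, h.2.2⟩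
  · rcases htop j h₂ (Or.inl hmem) with h | h
    · exact h.not_gt h₁
    · exact h₁.ne' h.1
  · exact (htop j hj (Or.inr hyj)).imp_right fun h => ⟨h.1, h.2.1.2, h.2.2⟩
  · rcases htop j h₂ (Or.inr hmem) with h | h
    · exact h.not_gt h₁
    · exact h₁.ne' h.1

/-- If a leaf of the time window `[-T, 0)` meets `{x, y}`, and every such leaf contains both points
in its interior, then there is a top leaf. -/
theorem exists_mem_topLeaf {a : ℝ} {p : ℕ → Plane × ℝ} {X : ℕ → Compacts Plane}
    (h : TameConfig a p X) {x y : Plane} {T : ℝ}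
    (hex : ∃ j, (p j).2 ∈ Ico (-T) 0 ∧ (p j, X j) ∈ touching x y)
    (hall : ∀ j, (p j).2 ∈ Ico (-T) 0 → (p j, X j) ∈ touching x y → (p j, X j) ∈ engulfing x y) :
    ∃ i, (p, X) ∈ topLeaf x y i := by
  set J : Set ℕ := {j | (p j).2 ∈ Ico (-T) 0 ∧ (p j, X j) ∈ touching x y} with hJ
  have hJfin : J.Finite := by
    refine (h.finite_meeting (max ‖x‖ ‖y‖) (-T)).subset ?_
    rintro j ⟨hj, hx | hy⟩
    · exact ⟨hj.1, hj.2, x, hx, le_max_left _ _⟩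
    · exact ⟨hj.1, hj.2, y, hy, le_max_right _ _⟩
  have hmax : ∃ i, i ∈ J ∧ ∀ j ∈ J, (p j).2 ≤ (p i).2 :=
    exists_max_image J (fun j => (p j).2) hJfin hex
  classical
  obtain ⟨hiJ, hi⟩ := Nat.find_spec hmax
  refine ⟨Nat.find hmax, hiJ.1.2, hall _ hiJ.1 hiJ.2, fun j hj hjt => ?_⟩
  dsimp only at hj hjt ⊢
  rcases lt_or_ge (p j).2 (p (Nat.find hmax)).2 with hlt | hge
  · exact Or.inl hlt
  · have hjJ : j ∈ J := ⟨⟨hiJ.1.1.trans hge, hj⟩, hjt⟩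
    exact Or.inr ⟨le_antisymm (hi j hjJ) hge, hall j hjJ.1 hjt,
      Nat.find_min' hmax ⟨hjJ, fun k hk => (hi k hk).trans hge⟩⟩

/-! ### Rate of separation of two points -/

theorem measurableSet_volume_frontier_eq_zero :
    MeasurableSet {K : Compacts Plane | volume (frontier (K : Set Plane)) = 0} := by
  have hg : MeasurableSet {q : Compacts Plane × Plane | q.2 ∈ frontier (q.1 : Set Plane)} := by
    simp only [fun K : Compacts Plane => K.isCompact.isClosed.frontier_eq]
    exact (measurable_swap measurableSet_mem).diff (measurable_swap measurableSet_mem_interior)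
  exact measurable_measure_prodMk_left (ν := volume) hg (measurableSet_singleton 0)

/-- The points `u` such that `{u, u + h}` meets `K` but is not contained in its interior. -/
def mismatch (K : Set Plane) (h : Plane) : Set Plane :=
  {u | (u ∈ K ∨ u + h ∈ K) ∧ ¬ (u ∈ interior K ∧ u + h ∈ interior K)}

theorem measurableSet_mismatch_graph (h : Plane) :
    MeasurableSet {q : Compacts Plane × Plane | q.2 ∈ mismatch (q.1 : Set Plane) h} := by
  have h₀ : Measurable fun q : Compacts Plane × Plane => (q.2, q.1) := measurable_swap
  have h₁ : Measurable fun q : Compacts Plane × Plane => (q.2 + h, q.1) :=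
    (measurable_snd.add_const h).prodMk measurable_fst
  exact ((h₀ measurableSet_mem).union (h₁ measurableSet_mem)).inter
    ((h₀ measurableSet_mem_interior).inter (h₁ measurableSet_mem_interior)).compl

theorem measurable_volume_mismatch (h : Plane) :
    Measurable fun K : Compacts Plane => volume (mismatch (K : Set Plane) h) :=
  measurable_measure_prodMk_left (measurableSet_mismatch_graph h)

theorem measurableSet_mismatch (K : Compacts Plane) (h : Plane) :
    MeasurableSet (mismatch (K : Set Plane) h) :=
  (measurable_prodMk_left : Measurable (Prod.mk K)) (measurableSet_mismatch_graph h)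

theorem volume_mismatch_le (K : Set Plane) (h : Plane) :
    volume (mismatch K h) ≤ 2 * volume K := by
  have hsub : mismatch K h ⊆ K ∪ (fun u => u + h) ⁻¹' K := fun u hu => hu.1
  refine (measure_mono hsub).trans ((measure_union_le _ _).trans (le_of_eq ?_))
  rw [measure_preimage_add_right, two_mul]

/-- Translations act continuously on a compact set with negligible boundary: a point off the boundary
stays on its side of it under small displacements. -/
theorem tendsto_volume_mismatch {K : Compacts Plane} (hK : volume (frontier (K : Set Plane)) = 0) :
    Tendsto (fun h => volume (mismatch (K : Set Plane) h)) (𝓝 0) (𝓝 0) := by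
  have hbd : ∀ᶠ h in 𝓝 (0 : Plane), ∀ᵐ u : Plane,
      (mismatch (K : Set Plane) h).indicator (1 : Plane → ℝ≥0∞) u ≤
        (Metric.cthickening 1 (K : Set Plane)).indicator 1 u := by
    filter_upwards [Metric.closedBall_mem_nhds (0 : Plane) one_pos] with h hh
    refine Eventually.of_forall fun u => indicator_le_indicator_of_subset ?_ (fun _ => zero_le) u
    rintro u ⟨hu | hu, -⟩
    · exact Metric.self_subset_cthickening _ hu
    · exact Metric.mem_cthickening_of_dist_le u (u + h) 1 _ hu (by simpa using hh)
  have hfin : ∫⁻ u, (Metric.cthickening 1 (K : Set Plane)).indicator (1 : Plane → ℝ≥0∞) u ≠ ∞ := by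
    rw [lintegral_indicator_one Metric.isClosed_cthickening.measurableSet]
    exact K.isCompact.cthickening.measure_lt_top.ne
  have hlim : ∀ᵐ u : Plane, Tendsto
      (fun h => (mismatch (K : Set Plane) h).indicator (1 : Plane → ℝ≥0∞) u) (𝓝 0) (𝓝 0) := by
    filter_upwards [compl_mem_ae_iff.2 hK] with u hu
    have hadd : Tendsto (fun h : Plane => u + h) (𝓝 0) (𝓝 u) := by
      simpa using (continuous_const_add u).tendsto 0
    refine tendsto_nhds_of_eventually_eq ?_
    by_cases huK : u ∈ (K : Set Plane)
    · have hi : u ∈ interior (K : Set Plane) := by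
        by_contra hi
        exact hu ⟨subset_closure huK, hi⟩
      filter_upwards [hadd (isOpen_interior.mem_nhds hi)] with h hh
      exact indicator_of_notMem (fun hm => hm.2 ⟨hi, hh⟩) _
    · filter_upwards [hadd (K.isCompact.isClosed.isOpen_compl.mem_nhds huK)] with h hh
      exact indicator_of_notMem (fun hm => hm.1.elim huK hh) _
  have := tendsto_lintegral_filter_of_dominated_convergence _
    (Eventually.of_forall fun h => measurable_one.indicator (measurableSet_mismatch K h)) hbd hfin
    hlim
  simpa only [lintegral_indicator_one (measurableSet_mismatch K _), lintegral_zero] using this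

theorem coe_scale (r : ℝ) (K : Compacts Plane) : (scale r K : Set Plane) = r • (K : Set Plane) :=
  rfl

theorem volume_smul_set (r : ℝ) (S : Set Plane) :
    volume (r • S) = ENNReal.ofReal (r ^ 2) * volume S := by
  rw [Measure.addHaar_smul, finrank_euclideanSpace_fin, abs_of_nonneg (sq_nonneg r)]

theorem volume_frontier_scale {r : ℝ} (hr : r ≠ 0) {K : Compacts Plane}
    (hK : volume (frontier (K : Set Plane)) = 0) :
    volume (frontier (scale r K : Set Plane)) = 0 := by
  have : frontier (scale r K : Set Plane) = r • frontier (K : Set Plane) := by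
    rw [coe_scale, frontier, frontier, closure_smul₀' hr, interior_smul₀ hr, smul_set_sdiff₀ hr]
  rw [this, volume_smul_set, hK, mul_zero]

/-- Up to the normalizing constant of `sizeLaw`, the intensity in time of the leaves that meet a pair
of points with difference `h` without containing both in their interior, for all radii `R ≤ r₁`. It
does not depend on the lower cutoff `r₀`. -/
def mismatchRate (α r₁ : ℝ) (μ : Measure (Compacts Plane)) (h : Plane) : ℝ≥0∞ :=
  ∫⁻ p, ENNReal.ofReal (p.1 ^ (-α)) * volume (mismatch (scale p.1 p.2 : Set Plane) h)
    ∂((volume.restrict (Ioc 0 r₁)).prod μ)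

theorem measurable_mismatchRate_integrand (α : ℝ) (h : Plane) :
    Measurable fun p : ℝ × Compacts Plane =>
      ENNReal.ofReal (p.1 ^ (-α)) * volume (mismatch (scale p.1 p.2 : Set Plane) h) :=
  (ENNReal.measurable_ofReal.comp (measurable_fst.pow_const _)).mul
    ((measurable_volume_mismatch h).comp measurable_scale)

/-- The condition `α < 3` makes `r ↦ r ^ (2 - α)` integrable at `0`, which provides the domination
uniformly in the lower cutoff. -/
theorem tendsto_mismatchRate {α r₁ a : ℝ} (hα : α < 3) (hr₁ : 0 < r₁)
    {μ : Measure (Compacts Plane)} [IsProbabilityMeasure μ]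
    (hsub : ∀ᵐ K : Compacts Plane ∂μ, (K : Set Plane) ⊆ Metric.closedBall 0 a)
    (hbd : ∀ᵐ K : Compacts Plane ∂μ, volume (frontier (K : Set Plane)) = 0) :
    Tendsto (mismatchRate α r₁ μ) (𝓝 0) (𝓝 0) := by
  have hpos : ∀ᵐ p ∂((volume.restrict (Ioc 0 r₁)).prod μ), p.1 ∈ Ioc 0 r₁ :=
    Measure.quasiMeasurePreserving_fst.ae (ae_restrict_mem measurableSet_Ioc)
  have hsub' := (Measure.quasiMeasurePreserving_snd (μ := volume.restrict (Ioc 0 r₁))).ae hsub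
  have hbd' := (Measure.quasiMeasurePreserving_snd (μ := volume.restrict (Ioc 0 r₁))).ae hbd
  set V : ℝ≥0∞ := volume (Metric.closedBall (0 : Plane) a) with hV
  have hVfin : V ≠ ∞ := measure_closedBall_lt_top.ne
  have hm : Measurable fun r : ℝ => ENNReal.ofReal (r ^ (2 - α)) :=
    ENNReal.measurable_ofReal.comp (measurable_id.pow_const _)
  have hfin : ∫⁻ p : ℝ × Compacts Plane, ENNReal.ofReal (p.1 ^ (2 - α)) * (2 * V)
      ∂((volume.restrict (Ioc 0 r₁)).prod μ) ≠ ∞ := by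
    have hint : IntegrableOn (fun r : ℝ => r ^ (2 - α)) (Ioc 0 r₁) :=
      (intervalIntegrable_iff_integrableOn_Ioc_of_le hr₁.le).1
        (intervalIntegral.intervalIntegrable_rpow' (by linarith))
    have hm₂ : Measurable fun p : ℝ × Compacts Plane =>
        ENNReal.ofReal (p.1 ^ (2 - α)) * (2 * V) := (hm.comp measurable_fst).mul_const _
    rw [lintegral_prod _ hm₂.aemeasurable]
    simp only [lintegral_const, measure_univ, mul_one]
    rw [lintegral_mul_const _ hm]
    refine ENNReal.mul_ne_top ?_ (ENNReal.mul_ne_top ENNReal.ofNat_ne_top hVfin)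
    exact (hint.lintegral_lt_top).ne
  have := tendsto_lintegral_filter_of_dominated_convergence
    (μ := (volume.restrict (Ioc 0 r₁)).prod μ) (l := 𝓝 (0 : Plane)) (f := fun _ => 0)
    (F := fun h p => ENNReal.ofReal (p.1 ^ (-α)) * volume (mismatch (scale p.1 p.2 : Set Plane) h))
    _ (Eventually.of_forall fun h => measurable_mismatchRate_integrand α h)
    (Eventually.of_forall fun h => ?_) hfin ?_
  · simp only [lintegral_zero] at this
    exact this
  · filter_upwards [hpos, hsub'] with p hp hK
    calc ENNReal.ofReal (p.1 ^ (-α)) * volume (mismatch (scale p.1 p.2 : Set Plane) h)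
        ≤ ENNReal.ofReal (p.1 ^ (-α)) * (2 * (ENNReal.ofReal (p.1 ^ 2) * V)) := by
          gcongr
          refine (volume_mismatch_le _ _).trans ?_
          rw [coe_scale, volume_smul_set]
          gcongr
          exact measure_mono hK
      _ = ENNReal.ofReal (p.1 ^ (-α)) * ENNReal.ofReal (p.1 ^ 2) * (2 * V) := by ring
      _ = ENNReal.ofReal (p.1 ^ (2 - α)) * (2 * V) := by
          rw [← ENNReal.ofReal_mul (Real.rpow_nonneg hp.1.le _), ← Real.rpow_natCast,
            ← Real.rpow_add hp.1]
          congr 3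
          push_cast
          ring
  · filter_upwards [hpos, hbd'] with p hp hK
    have := ENNReal.Tendsto.const_mul (a := ENNReal.ofReal (p.1 ^ (-α)))
      (tendsto_volume_mismatch (volume_frontier_scale hp.1.ne' hK)) (Or.inr ENNReal.ofReal_ne_top)
    simpa only [mul_zero] using this

/-! ### Estimates for the grain law -/

/-- The normalizing constant of `sizeLaw`. -/
def sizeConst (α r₀ r₁ : ℝ) : ℝ := (α - 1) / (r₀ ^ (1 - α) - r₁ ^ (1 - α))

theorem sizeConst_pos {α r₀ r₁ : ℝ} (hα : 1 < α) (hr₀ : 0 < r₀) (hr : r₀ < r₁) :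
    0 < sizeConst α r₀ r₁ :=
  div_pos (by linarith) (sub_pos.2 (Real.rpow_lt_rpow_of_neg hr₀ hr (by linarith)))

theorem measurable_sizeLaw_density (α r₀ r₁ : ℝ) : Measurable fun r : ℝ =>
    ENNReal.ofReal ((α - 1) / (r₀ ^ (1 - α) - r₁ ^ (1 - α)) * r ^ (-α)) :=
  ENNReal.measurable_ofReal.comp ((measurable_id.pow_const _).const_mul _)

theorem lintegral_grainLaw {α r₀ r₁ : ℝ} (hα : 1 < α) (hr₀ : 0 < r₀) (hr : r₀ < r₁)
    (μ : Measure (Compacts Plane)) [IsProbabilityMeasure μ] {f : Compacts Plane → ℝ≥0∞}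
    (hf : Measurable f) :
    ∫⁻ K, f K ∂(grainLaw α r₀ r₁ μ) = ENNReal.ofReal (sizeConst α r₀ r₁) *
      ∫⁻ p, ENNReal.ofReal (p.1 ^ (-α)) * f (scale p.1 p.2)
        ∂((volume.restrict (Icc r₀ r₁)).prod μ) := by
  have hd := measurable_sizeLaw_density α r₀ r₁
  have hd₂ : Measurable fun p : ℝ × Compacts Plane =>
      ENNReal.ofReal ((α - 1) / (r₀ ^ (1 - α) - r₁ ^ (1 - α)) * p.1 ^ (-α)) :=
    hd.comp measurable_fst
  have hfs : Measurable fun p : ℝ × Compacts Plane => f (scale p.1 p.2) := hf.comp measurable_scale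
  rw [grainLaw, lintegral_map hf measurable_scale, sizeLaw, prod_withDensity_left hd,
    lintegral_withDensity_eq_lintegral_mul _ hd₂ hfs,
    ← lintegral_const_mul]
  · refine lintegral_congr fun p => ?_
    simp only [Pi.mul_apply]
    rw [← sizeConst, ENNReal.ofReal_mul (sizeConst_pos hα hr₀ hr).le, mul_assoc]
  · exact (ENNReal.measurable_ofReal.comp (measurable_fst.pow_const _)).mul hfs

/-- The mean number of leaves in the window `[-T, 0)` that meet `{x, y}` without containing both
points in their interior. -/
theorem prod_grainLaw_touching_diff_engulfing_le {α r₀ r₁ : ℝ} (hα : 1 < α) (hr₀ : 0 < r₀)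
    (hr : r₀ < r₁) (μ : Measure (Compacts Plane)) [IsProbabilityMeasure μ]
    [SFinite (grainLaw α r₀ r₁ μ)] (x y : Plane) (T : ℝ) :
    ((volume : Measure (Plane × ℝ)).prod (grainLaw α r₀ r₁ μ))
        ((fun q => q.1.2) ⁻¹' Ico (-T) 0 ∩ (touching x y \ engulfing x y)) ≤
      ENNReal.ofReal (T * sizeConst α r₀ r₁) * mismatchRate α r₁ μ (y - x) := by
  have hW : MeasurableSet ((fun q : (Plane × ℝ) × Compacts Plane => q.1.2) ⁻¹' Ico (-T) 0 ∩
      (touching x y \ engulfing x y)) :=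
    ((measurable_snd.comp measurable_fst) measurableSet_Ico).inter
      ((measurableSet_touching x y).diff (measurableSet_engulfing x y))
  have hsec : ∀ K : Compacts Plane, volume ((fun s : Plane × ℝ => (s, K)) ⁻¹'
      ((fun q => q.1.2) ⁻¹' Ico (-T) 0 ∩ (touching x y \ engulfing x y))) =
      volume (mismatch (K : Set Plane) (y - x)) * ENNReal.ofReal T := by
    intro K
    have hset : ((fun s : Plane × ℝ => (s, K)) ⁻¹'
        ((fun q => q.1.2) ⁻¹' Ico (-T) 0 ∩ (touching x y \ engulfing x y))) =
        ((fun u => x - u) ⁻¹' mismatch (K : Set Plane) (y - x)) ×ˢ Ico (-T) 0 := by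
      ext ⟨u, t⟩
      simp only [touching, engulfing, mismatch, mem_vadd_iff_sub_mem, mem_preimage, mem_inter_iff,
        Set.mem_sdiff, mem_ofPred_eq, mem_prod, show x - u + (y - x) = y - u by abel]
      tauto
    rw [hset, Measure.volume_eq_prod, Measure.prod_prod, Real.volume_Ico, zero_sub, neg_neg,
      (Measure.measurePreserving_sub_left volume x).measure_preimage
        (measurableSet_mismatch K _).nullMeasurableSet]
  rw [Measure.prod_apply_symm hW]
  simp_rw [hsec]
  rw [lintegral_mul_const _ (measurable_volume_mismatch _),
    lintegral_grainLaw hα hr₀ hr μ (measurable_volume_mismatch _), mismatchRate,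
    lintegral_prod _ (measurable_mismatchRate_integrand α _).aemeasurable,
    lintegral_prod _ (measurable_mismatchRate_integrand α _).aemeasurable, mul_comm, ← mul_assoc,
    mul_comm T, ENNReal.ofReal_mul (sizeConst_pos hα hr₀ hr).le, mul_comm (ENNReal.ofReal T)]
  gcongr

/-- A leaf has radius factor at least `r₁ / 2` with probability at least a constant times the
normalizing constant of `sizeLaw`; it then contains a fixed disk. -/
theorem le_grainLaw_ball_subset {α r₀ r₁ a : ℝ} (hα : 1 < α) (hr₀ : 0 < r₀) (hr : r₀ ≤ r₁ / 2)
    (hr₁ : 0 < r₁) (ha : 0 < a) {μ : Measure (Compacts Plane)} [IsProbabilityMeasure μ]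
    (hsub : ∀ᵐ K : Compacts Plane ∂μ, Metric.ball 0 a ⊆ (K : Set Plane)) :
    ENNReal.ofReal (sizeConst α r₀ r₁ * (r₁ ^ (-α) * (r₁ / 2))) ≤
      grainLaw α r₀ r₁ μ {K | Metric.ball (0 : Plane) (r₁ / 2 * a) ⊆ (K : Set Plane)} := by
  have hr₀₁ : r₀ < r₁ := by linarith
  have hS := measurableSet_superset_of_isOpen
    (Metric.isOpen_ball (x := (0 : Plane)) (ε := r₁ / 2 * a))
  set S := {K : Compacts Plane | Metric.ball (0 : Plane) (r₁ / 2 * a) ⊆ (K : Set Plane)}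
  have hm : Measurable fun p : ℝ × Compacts Plane =>
      ENNReal.ofReal (p.1 ^ (-α)) * S.indicator 1 (scale p.1 p.2) :=
    (ENNReal.measurable_ofReal.comp (measurable_fst.pow_const _)).mul
      ((measurable_one.indicator hS).comp measurable_scale)
  rw [← lintegral_indicator_one hS,
    lintegral_grainLaw hα hr₀ hr₀₁ μ (measurable_one.indicator hS),
    ENNReal.ofReal_mul (sizeConst_pos hα hr₀ hr₀₁).le, lintegral_prod _ hm.aemeasurable]
  gcongr
  have hin : ∀ r ∈ Icc (r₁ / 2) r₁, ENNReal.ofReal (r₁ ^ (-α)) ≤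
      ∫⁻ K, ENNReal.ofReal (r ^ (-α)) * S.indicator 1 (scale r K) ∂μ := by
    intro r hr'
    have hr_pos : 0 < r := by linarith [hr'.1]
    calc ENNReal.ofReal (r₁ ^ (-α)) = ∫⁻ _, ENNReal.ofReal (r₁ ^ (-α)) ∂μ := by simp
      _ ≤ _ := by
        refine lintegral_mono_ae ?_
        filter_upwards [hsub] with K hK
        have hmem : scale r K ∈ S := by
          change Metric.ball (0 : Plane) (r₁ / 2 * a) ⊆ r • (K : Set Plane)
          refine Subset.trans ?_ (smul_set_mono hK)
          rw [smul_ball hr_pos.ne', smul_zero, Real.norm_of_nonneg hr_pos.le]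
          exact Metric.ball_subset_ball (mul_le_mul_of_nonneg_right hr'.1 ha.le)
        rw [indicator_of_mem hmem, Pi.one_apply, mul_one]
        exact ENNReal.ofReal_le_ofReal
          (Real.rpow_le_rpow_of_nonpos hr_pos hr'.2 (by linarith))
  calc ENNReal.ofReal (r₁ ^ (-α) * (r₁ / 2))
      = ∫⁻ _ in Icc (r₁ / 2) r₁, ENNReal.ofReal (r₁ ^ (-α)) := by
        rw [setLIntegral_const, Real.volume_Icc, ← ENNReal.ofReal_mul (by positivity)]
        congr 2
        ring
    _ ≤ ∫⁻ r in Icc (r₁ / 2) r₁,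
          ∫⁻ K, ENNReal.ofReal (r ^ (-α)) * S.indicator 1 (scale r K) ∂μ :=
        setLIntegral_mono' measurableSet_Icc hin
    _ ≤ _ := lintegral_mono_set (Icc_subset_Icc_left hr)

theorem ae_grainLaw_subset_closedBall {α r₀ r₁ a : ℝ} (hr₀ : 0 < r₀)
    {μ : Measure (Compacts Plane)} [IsProbabilityMeasure μ]
    (hsub : ∀ᵐ K : Compacts Plane ∂μ, (K : Set Plane) ⊆ Metric.closedBall 0 a) :
    ∀ᵐ K : Compacts Plane ∂(grainLaw α r₀ r₁ μ), (K : Set Plane) ⊆ Metric.closedBall 0 (r₁ * a) := by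
  have hm := measurableSet_subset_of_isClosed
    (Metric.isClosed_closedBall (x := (0 : Plane)) (ε := r₁ * a))
  refine (ae_map_iff measurable_scale.aemeasurable hm).2 ?_
  have h₁ : ∀ᵐ r ∂(sizeLaw α r₀ r₁), r ∈ Icc r₀ r₁ :=
    (withDensity_absolutelyContinuous _ _).ae_le (ae_restrict_mem measurableSet_Icc)
  have hs : SFinite (sizeLaw α r₀ r₁) := by unfold sizeLaw; infer_instance
  filter_upwards [Measure.quasiMeasurePreserving_fst.ae h₁,
    Measure.quasiMeasurePreserving_snd.ae hsub] with p hp hK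
  rintro _ ⟨u, hu, rfl⟩
  have hua : ‖u‖ ≤ a := by simpa using hK hu
  have hp₀ : 0 < p.1 := hr₀.trans_le hp.1
  rw [mem_closedBall_zero_iff, norm_smul, Real.norm_of_nonneg hp₀.le]
  exact mul_le_mul hp.2 hua (norm_nonneg u) (hp₀.le.trans hp.2)

/-! ### Two-point estimate -/

section Leaves

variable {Ω Ω₀ : Type*} [MeasurableSpace Ω] [MeasurableSpace Ω₀] {P : Measure Ω} {P₀ : Measure Ω₀}
  {ξ : ℕ → Ω → Plane × ℝ} {X : ℕ → Ω → Compacts Plane} {μX : Measure (Compacts Plane)}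

theorem ae_tameConfig [IsProbabilityMeasure P] (hξ : IsPoissonProcess ξ volume P)
    (hX : ∀ i, HasLaw (X i) μX P) {a : ℝ}
    (ha : ∀ᵐ K : Compacts Plane ∂μX, (K : Set Plane) ⊆ Metric.closedBall 0 a) :
    ∀ᵐ ω ∂P, TameConfig a (fun i => ξ i ω) (fun i => X i ω) := by
  refine (ae_all_iff.2 fun i => ?_).and (ae_all_iff.2 fun n => ?_)
  · rw [← (hX i).map_eq] at ha
    exact ae_of_ae_map (hX i).aemeasurable ha
  · refine hξ.ae_finite (Metric.isClosed_closedBall.measurableSet.prod measurableSet_Icc) ?_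
    rw [Measure.volume_eq_prod, Measure.prod_prod]
    exact ENNReal.mul_ne_top measure_closedBall_lt_top.ne measure_Icc_lt_top.ne

/-- The top leaf is chosen independently of the colors, so on the event that it exists the two values
differ as much as the values of a single copy of `C₀`. -/
theorem measure_dist_colored_gt_le [IsProbabilityMeasure P]
    {C : ℕ → Ω → Plane → ℝ} {C₀ : Plane → Ω₀ → ℝ}
    (hξ : ∀ i, Measurable (ξ i)) (hX : ∀ i, Measurable (X i))
    (hC₀ : ∀ i, IdentDistrib (C i) (fun ω y => C₀ y ω) P P₀)
    (hind : IndepFun (fun ω => (fun i => ξ i ω, fun i => X i ω)) (fun ω i => C i ω) P) {a : ℝ}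
    (htame : ∀ᵐ ω ∂P, TameConfig a (fun i => ξ i ω) (fun i => X i ω)) (x y : Plane) (ε : ℝ) :
    P {ω | ε < dist (colored (visiblePart (fun i => ξ i ω) (fun i => X i ω)) (fun i => C i ω) x)
        (colored (visiblePart (fun i => ξ i ω) (fun i => X i ω)) (fun i => C i ω) y)} ≤
      P {ω | ∀ i, ((fun i => ξ i ω, fun i => X i ω) : _ × _) ∉ topLeaf x y i} +
        P₀ {ω | ε < dist (C₀ x ω) (C₀ y ω)} := by
  set q : Ω → (ℕ → Plane × ℝ) × (ℕ → Compacts Plane) := fun ω => (fun i => ξ i ω, fun i => X i ω)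
  have hq : Measurable q := (measurable_pi_lambda _ hξ).prodMk (measurable_pi_lambda _ hX)
  set D : Set (Plane → ℝ) := {c | ε < dist (c x) (c y)}
  have hD : MeasurableSet D :=
    measurableSet_lt measurable_const ((measurable_pi_apply x).dist (measurable_pi_apply y))
  have hcov : P {ω | ε < dist (colored (visiblePart (q ω).1 (q ω).2) (fun i => C i ω) x)
      (colored (visiblePart (q ω).1 (q ω).2) (fun i => C i ω) y)} ≤
      P ({ω | ∀ i, q ω ∉ topLeaf x y i} ∪ ⋃ i, (q ⁻¹' topLeaf x y i ∩ C i ⁻¹' D)) := by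
    refine measure_mono_ae ?_
    filter_upwards [htame] with ω hω hgt
    by_cases h : ∃ i, q ω ∈ topLeaf x y i
    · obtain ⟨i, hi⟩ := h
      obtain ⟨h₁, h₂⟩ := colored_eq_of_mem_topLeaf hω (fun i => C i ω) hi
      refine Or.inr (mem_iUnion.2 ⟨i, hi, ?_⟩)
      change ε < dist (C i ω x) (C i ω y)
      rw [← h₁, ← h₂]
      exact hgt
    · exact Or.inl (not_exists.1 h)
  refine hcov.trans ((measure_union_le _ _).trans (add_le_add_right ?_ _))
  have hterm : ∀ i, P (q ⁻¹' topLeaf x y i ∩ C i ⁻¹' D) =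
      P (q ⁻¹' topLeaf x y i) * P₀ {ω | ε < dist (C₀ x ω) (C₀ y ω)} := by
    intro i
    have hi : IndepFun q (C i) P := hind.comp measurable_id (measurable_pi_apply i)
    rw [hi.measure_inter_preimage_eq_mul _ _ (measurableSet_topLeaf x y i) hD,
      (hC₀ i).measure_mem_eq hD]
    rfl
  refine (measure_iUnion_le _).trans ?_
  simp_rw [hterm]
  rw [ENNReal.tsum_mul_right, ← measure_iUnion
    (fun i j hij => (pairwise_disjoint_topLeaf x y hij).preimage q)
    (fun i => hq (measurableSet_topLeaf x y i))]
  exact mul_le_of_le_one_left zero_le prob_le_one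

/-- A top leaf exists unless no leaf of the window `[-T, 0)` positioned within `ρ` of `x` contains the
disk of radius `ρ` about its position, which would cover `x`, or some leaf of the window meets
`{x, y}` without containing both points in its interior. -/
theorem measure_forall_notMem_topLeaf_le [IsProbabilityMeasure P]
    (hξ : IsPoissonProcess ξ volume P) (hX : ∀ i, Measurable (X i)) (hlaw : ∀ i, HasLaw (X i) μX P)
    (hXind : iIndepFun X P) (hind : IndepFun (fun ω i => ξ i ω) (fun ω i => X i ω) P) {a : ℝ}
    (htame : ∀ᵐ ω ∂P, TameConfig a (fun i => ξ i ω) (fun i => X i ω)) (x y : Plane) {T : ℝ}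
    (hT : 0 ≤ T) (ρ : ℝ) :
    P {ω | ∀ i, ((fun i => ξ i ω, fun i => X i ω) : _ × _) ∉ topLeaf x y i} ≤
      ENNReal.ofReal (Real.exp (-(volume.real (Metric.ball (0 : Plane) ρ) * T *
        μX.real {K | Metric.ball (0 : Plane) ρ ⊆ (K : Set Plane)}))) +
      ((volume : Measure (Plane × ℝ)).prod μX)
        ((fun q => q.1.2) ⁻¹' Ico (-T) 0 ∩ (touching x y \ engulfing x y)) := by
  have hvol : volume (Metric.ball x ρ ×ˢ Ico (-T) 0) =
      volume (Metric.ball (0 : Plane) ρ) * ENNReal.ofReal T := by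
    rw [Measure.volume_eq_prod, Measure.prod_prod, Real.volume_Ico, zero_sub, neg_neg,
      Measure.addHaar_ball_center]
  have hvoid := hξ.measure_forall_notMem_le hX hlaw hXind hind
    (Metric.isOpen_ball.measurableSet.prod measurableSet_Ico)
    (by rw [hvol]; exact ENNReal.mul_ne_top measure_ball_lt_top.ne ENNReal.ofReal_ne_top)
    (measurableSet_superset_of_isOpen (Metric.isOpen_ball (x := (0 : Plane)) (ε := ρ)))
  rw [hvol, ENNReal.toReal_mul, ENNReal.toReal_ofReal hT] at hvoid
  have hW : MeasurableSet ((fun q : (Plane × ℝ) × Compacts Plane => q.1.2) ⁻¹' Ico (-T) 0 ∩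
      (touching x y \ engulfing x y)) :=
    ((measurable_snd.comp measurable_fst) measurableSet_Ico).inter
      ((measurableSet_touching x y).diff (measurableSet_engulfing x y))
  refine le_trans ?_ (add_le_add hvoid (hξ.measure_exists_mem_le hX hlaw hind hW))
  refine le_trans (measure_mono_ae ?_) (measure_union_le _ _)
  filter_upwards [htame] with ω hω hno
  by_contra hcon
  obtain ⟨h₁, h₂⟩ := not_or.1 hcon
  have h₁' : ∃ i, ξ i ω ∈ Metric.ball x ρ ×ˢ Ico (-T) 0 ∧
      Metric.ball (0 : Plane) ρ ⊆ (X i ω : Set Plane) := by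
    by_contra h
    exact h₁ fun i hi hiX => h ⟨i, hi, hiX⟩
  obtain ⟨i, hi, hiX⟩ := h₁'
  have hxi : x - (ξ i ω).1 ∈ Metric.ball (0 : Plane) ρ := by
    rw [mem_ball_zero_iff, ← dist_eq_norm, dist_comm]
    exact hi.1
  obtain ⟨k, hk⟩ := exists_mem_topLeaf hω (x := x) (y := y) (T := T)
    ⟨i, hi.2, Or.inl (mem_vadd_iff_sub_mem.2 (hiX hxi))⟩
    fun j hj hjt => by_contra fun hje => h₂ ⟨j, hj, hjt, hje⟩
  exact hno k hk

/-- The two-point estimate, uniform in the cutoff `r₀`: the time window has length `k / sizeConst`,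
so that the lower bound on the chance to cover `x` and the upper bound on the number of leaves that
separate `x` from `y` are both of order one. -/
theorem measure_dist_gt_le_of_isColoredDeadLeaves [IsProbabilityMeasure P] {C₀ : Plane → Ω₀ → ℝ}
    {Z : Plane → Ω → ℝ} {α r₀ r₁ a₁ a₂ : ℝ} (hα : 1 < α) (hr₀ : 0 < r₀) (hr : r₀ ≤ r₁ / 2)
    (hr₁ : 0 < r₁) (ha₁ : 0 < a₁) {μ : Measure (Compacts Plane)} [IsProbabilityMeasure μ]
    (hin : ∀ᵐ K : Compacts Plane ∂μ, Metric.ball 0 a₁ ⊆ (K : Set Plane))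
    (hout : ∀ᵐ K : Compacts Plane ∂μ, (K : Set Plane) ⊆ Metric.closedBall 0 a₂)
    (hZ : IsColoredDeadLeaves (grainLaw α r₀ r₁ μ) C₀ P₀ Z P) (x y : Plane) (ε : ℝ) {k : ℝ}
    (hk : 0 ≤ k) :
    P {ω | ε < dist (Z x ω) (Z y ω)} ≤
      ENNReal.ofReal (Real.exp (-(k * (volume.real (Metric.ball (0 : Plane) (r₁ / 2 * a₁)) *
        (r₁ ^ (-α) * (r₁ / 2)))))) +
      ENNReal.ofReal k * mismatchRate α r₁ μ (y - x) + P₀ {ω | ε < dist (C₀ x ω) (C₀ y ω)} := by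
  obtain ⟨ξ, X, C, hξ, hX, hlaw, hXind, -, hC₀, -, hind, hindC, hZeq⟩ := hZ
  have hr₀₁ : r₀ < r₁ := by linarith
  have hprob : IsProbabilityMeasure (grainLaw α r₀ r₁ μ) := (hlaw 0).map_eq ▸
    Measure.isProbabilityMeasure_map (hX 0).aemeasurable
  have htame := ae_tameConfig hξ hlaw (ae_grainLaw_subset_closedBall (r₁ := r₁) (α := α) hr₀ hout)
  have hη := sizeConst_pos hα hr₀ hr₀₁
  simp_rw [hZeq]
  refine (measure_dist_colored_gt_le hξ.measurable hX hC₀ hindC htame x y ε).trans ?_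
  gcongr
  refine (measure_forall_notMem_topLeaf_le hξ hX hlaw hXind hind htame x y
    (T := k / sizeConst α r₀ r₁) (by positivity) (r₁ / 2 * a₁)).trans ?_
  refine add_le_add (ENNReal.ofReal_le_ofReal (Real.exp_le_exp.2 (neg_le_neg ?_))) ?_
  · have hq : sizeConst α r₀ r₁ * (r₁ ^ (-α) * (r₁ / 2)) ≤ (grainLaw α r₀ r₁ μ).real
        {K | Metric.ball (0 : Plane) (r₁ / 2 * a₁) ⊆ (K : Set Plane)} :=
      (ENNReal.ofReal_le_iff_le_toReal (measure_ne_top _ _)).1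
        (le_grainLaw_ball_subset hα hr₀ hr hr₁ ha₁ hin)
    calc k * (volume.real (Metric.ball (0 : Plane) (r₁ / 2 * a₁)) * (r₁ ^ (-α) * (r₁ / 2)))
        = volume.real (Metric.ball (0 : Plane) (r₁ / 2 * a₁)) * (k / sizeConst α r₀ r₁) *
            (sizeConst α r₀ r₁ * (r₁ ^ (-α) * (r₁ / 2))) := by
          field_simp
      _ ≤ _ := by gcongr
  · refine (prod_grainLaw_touching_diff_engulfing_le hα hr₀ hr₀₁ μ x y _).trans ?_
    rw [div_mul_cancel₀ _ hη.ne']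

end Leaves

/-! ### Passage to the limit -/

/-- Portmanteau for two-point laws: a bound on `P (|Z x - Z y| > ε)` that holds eventually along the
family passes to the limit field. -/
theorem FidiTendsto.measure_dist_gt_le {ι Ω : Type*} {Ω' : ι → Type*}
    [∀ i, MeasurableSpace (Ω' i)] [MeasurableSpace Ω] {Z : ∀ i, Plane → Ω' i → ℝ} {l : Filter ι}
    [l.NeBot] {I : Plane → Ω → ℝ} {P' : ∀ i, Measure (Ω' i)} [∀ i, IsProbabilityMeasure (P' i)]
    {P : Measure Ω} [IsProbabilityMeasure P] (h : FidiTendsto Z l I P' P) {x y : Plane} {ε : ℝ}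
    {b : ℝ≥0∞} (hb : ∀ᶠ i in l, P' i {ω | ε < dist (Z i x ω) (Z i y ω)} ≤ b) :
    P {ω | ε < dist (I x ω) (I y ω)} ≤ b := by
  have hxy := h 2 ![x, y]
  have hG : IsOpen {v : Fin 2 → ℝ | ε < dist (v 0) (v 1)} :=
    isOpen_lt continuous_const ((continuous_apply 0).dist (continuous_apply 1))
  have := ProbabilityMeasure.le_liminf_measure_open_of_tendsto hxy.tendsto hG
  simp only [ProbabilityMeasure.coe_mk] at this
  rw [Measure.map_apply_of_aemeasurable hxy.aemeasurable_limit hG.measurableSet] at this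
  refine this.trans (liminf_le_of_frequently_le' (Eventually.frequently ?_))
  filter_upwards [hb] with i hi
  rw [Measure.map_apply_of_aemeasurable (hxy.forall_aemeasurable i) hG.measurableSet]
  exact hi

theorem stochasticallyContinuous_of_measure_dist_gt_le {Ω Ω₀ : Type*} [MeasurableSpace Ω]
    [MeasurableSpace Ω₀] {P : Measure Ω} {P₀ : Measure Ω₀} {I : Plane → Ω → ℝ}
    {C₀ : Plane → Ω₀ → ℝ} (hC₀ : StochasticallyContinuous C₀ P₀) {c : ℝ} (hc : 0 < c)
    {F : Plane → ℝ≥0∞} (hF : Tendsto F (𝓝 0) (𝓝 0))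
    (h : ∀ x y : Plane, ∀ ε > 0, ∀ k ≥ 0, P {ω | ε < dist (I x ω) (I y ω)} ≤
      ENNReal.ofReal (Real.exp (-(k * c))) + ENNReal.ofReal k * F (y - x) +
        P₀ {ω | ε < dist (C₀ x ω) (C₀ y ω)}) : StochasticallyContinuous I P := by
  intro x
  refine tendstoInMeasure_iff_dist.2 fun ε hε => ?_
  have hC := tendstoInMeasure_iff_dist.1 (hC₀ x) (ε / 2) (half_pos hε)
  have hsub : Tendsto (fun y : Plane => F (y - x)) (𝓝 x) (𝓝 0) :=
    hF.comp (by simpa using (continuous_sub_right x).tendsto x)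
  refine ENNReal.tendsto_nhds_zero.2 fun δ hδ => ?_
  have hexp : Tendsto (fun k : ℝ => ENNReal.ofReal (Real.exp (-(k * c)))) atTop (𝓝 0) := by
    have : Tendsto (fun k : ℝ => Real.exp (-(k * c))) atTop (𝓝 0) :=
      Real.tendsto_exp_neg_atTop_nhds_zero.comp (tendsto_id.atTop_mul_const hc)
    simpa using ENNReal.tendsto_ofReal this
  have hδ' : 0 < δ / 2 := ENNReal.half_pos hδ.ne'
  obtain ⟨k, hkexp, hk⟩ := ((hexp.eventually (ge_mem_nhds hδ')).and (eventually_ge_atTop 0)).exists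
  have hrest : Tendsto (fun y : Plane => ENNReal.ofReal k * F (y - x) +
      P₀ {ω | ε / 2 ≤ dist (C₀ y ω) (C₀ x ω)}) (𝓝 x) (𝓝 0) := by
    have := (ENNReal.Tendsto.const_mul (a := ENNReal.ofReal k) hsub
      (Or.inr ENNReal.ofReal_ne_top)).add hC
    simpa only [mul_zero, add_zero] using this
  filter_upwards [hrest.eventually (ge_mem_nhds hδ')] with y hy
  calc P {ω | ε ≤ dist (I y ω) (I x ω)}
      ≤ P {ω | ε / 2 < dist (I x ω) (I y ω)} := measure_mono fun ω (hω : ε ≤ _) => by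
        change ε / 2 < dist (I x ω) (I y ω)
        rw [dist_comm]
        linarith
    _ ≤ ENNReal.ofReal (Real.exp (-(k * c))) + ENNReal.ofReal k * F (y - x) +
          P₀ {ω | ε / 2 < dist (C₀ x ω) (C₀ y ω)} := h x y _ (half_pos hε) k hk
    _ ≤ δ / 2 + (ENNReal.ofReal k * F (y - x) + P₀ {ω | ε / 2 ≤ dist (C₀ y ω) (C₀ x ω)}) := by
        rw [add_assoc]
        gcongr with ω
        intro hω
        rw [dist_comm]
        exact le_of_lt hω
    _ ≤ δ / 2 + δ / 2 := by gcongr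
    _ = δ := ENNReal.add_halves δ

end DeadLeaves

end

theorem mainTheorem9
    {α r₁ a₁ a₂ : ℝ} (hα₁ : 1 < α) (hα₃ : α < 3) (hr₁ : 0 < r₁) (ha₁ : 0 < a₁) (ha₂ : a₁ < a₂)
    -- the random compact set `Y`
    {ΩY : Type*} [MeasurableSpace ΩY] (PY : Measure ΩY) [IsProbabilityMeasure PY]
    (Y : ΩY → Compacts DeadLeaves.Plane) (hY : Measurable Y)
    (hY_disks : ∀ᵐ ω ∂PY, Metric.closedBall 0 a₁ ⊆ (Y ω : Set DeadLeaves.Plane) ∧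
      (Y ω : Set DeadLeaves.Plane) ⊆ Metric.closedBall 0 a₂)
    (hY_boundary : ∀ᵐ ω ∂PY, volume (frontier (Y ω : Set DeadLeaves.Plane)) = 0)
    -- the color field `C₀`
    {Ω₀ : Type*} [MeasurableSpace Ω₀] (P₀ : Measure Ω₀) [IsProbabilityMeasure P₀]
    (C₀ : DeadLeaves.Plane → Ω₀ → ℝ) (hC₀ : ∀ x, Measurable (C₀ x))
    (hC₀_cont : DeadLeaves.StochasticallyContinuous C₀ P₀)
    -- the colored dead leaves processes `Z r₀ = I(C₀, r₀, r₁)`, for `0 < r₀ < r₁`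
    {Ω : Set.Ioo 0 r₁ → Type*} [∀ r₀, MeasurableSpace (Ω r₀)]
    (P : ∀ r₀, Measure (Ω r₀)) [∀ r₀, IsProbabilityMeasure (P r₀)]
    (Z : ∀ r₀, DeadLeaves.Plane → Ω r₀ → ℝ)
    (hZ : ∀ r₀ : Set.Ioo 0 r₁, DeadLeaves.IsColoredDeadLeaves
      (DeadLeaves.grainLaw α r₀ r₁ (PY.map Y)) C₀ P₀ (Z r₀) (P r₀))
    -- the limit process `I = I(C₀, 0, r₁)`
    {ΩI : Type*} [MeasurableSpace ΩI] (PI : Measure ΩI) [IsProbabilityMeasure PI]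
    (I : DeadLeaves.Plane → ΩI → ℝ) (hI : ∀ x, Measurable (I x))
    (hI_lim : DeadLeaves.FidiTendsto Z (Filter.comap Subtype.val (𝓝[>] (0 : ℝ))) I P PI) :
    DeadLeaves.StochasticallyContinuous I PI ∧
    List.TFAE [DeadLeaves.HasMeasurableModification C₀ P₀, DeadLeaves.HasMeasurableVersion C₀ P₀,
      DeadLeaves.HasMeasurableBivariateLaws C₀ P₀] ∧
    (DeadLeaves.HasMeasurableVersion C₀ P₀ → DeadLeaves.HasMeasurableModification I PI) := by
  have hsc : DeadLeaves.StochasticallyContinuous I PI := by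
    have hμ : IsProbabilityMeasure (PY.map Y) := Measure.isProbabilityMeasure_map hY.aemeasurable
    have hball := Metric.isClosed_closedBall (x := (0 : DeadLeaves.Plane)) (ε := a₂)
    have hout : ∀ᵐ K : Compacts DeadLeaves.Plane ∂PY.map Y,
        (K : Set DeadLeaves.Plane) ⊆ Metric.closedBall 0 a₂ :=
      (ae_map_iff hY.aemeasurable (DeadLeaves.measurableSet_subset_of_isClosed hball)).2
        (hY_disks.mono fun _ h => h.2)
    have hin : ∀ᵐ K : Compacts DeadLeaves.Plane ∂PY.map Y,
        Metric.ball 0 a₁ ⊆ (K : Set DeadLeaves.Plane) :=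
      (ae_map_iff hY.aemeasurable
        (DeadLeaves.measurableSet_superset_of_isOpen Metric.isOpen_ball)).2
        (hY_disks.mono fun _ h => Metric.ball_subset_closedBall.trans h.1)
    have hbd : ∀ᵐ K : Compacts DeadLeaves.Plane ∂PY.map Y,
        volume (frontier (K : Set DeadLeaves.Plane)) = 0 :=
      (ae_map_iff hY.aemeasurable DeadLeaves.measurableSet_volume_frontier_eq_zero).2 hY_boundary
    have hev : ∀ᶠ r₀ : Set.Ioo 0 r₁ in Filter.comap Subtype.val (𝓝[>] (0 : ℝ)),
        (r₀ : ℝ) ≤ r₁ / 2 :=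
      tendsto_comap.eventually (mem_nhdsWithin_of_mem_nhds (Iic_mem_nhds (half_pos hr₁)))
    have hne : (Filter.comap (Subtype.val : Set.Ioo 0 r₁ → ℝ) (𝓝[>] (0 : ℝ))).NeBot :=
      comap_neBot fun t ht => by
        obtain ⟨r, hrt, hr⟩ := Filter.nonempty_of_mem (inter_mem ht (Ioo_mem_nhdsGT hr₁))
        exact ⟨⟨r, hr⟩, hrt⟩
    have hvol : 0 < volume.real (Metric.ball (0 : DeadLeaves.Plane) (r₁ / 2 * a₁)) :=
      ENNReal.toReal_pos (Metric.measure_ball_pos _ _ (by positivity)).ne' measure_ball_lt_top.ne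
    refine DeadLeaves.stochasticallyContinuous_of_measure_dist_gt_le hC₀_cont
      (c := volume.real (Metric.ball (0 : DeadLeaves.Plane) (r₁ / 2 * a₁)) *
        (r₁ ^ (-α) * (r₁ / 2))) (by positivity)
      (DeadLeaves.tendsto_mismatchRate hα₃ hr₁ hout hbd) fun x y ε _ k hk =>
      hI_lim.measure_dist_gt_le ?_
    filter_upwards [hev] with r₀ hr₀
    exact DeadLeaves.measure_dist_gt_le_of_isColoredDeadLeaves hα₁ r₀.2.1 hr₀ hr₁ ha₁ hin hout
      (hZ r₀) x y ε hk
  have hmod := hC₀_cont.hasMeasurableModification hC₀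
  -- Stochastic continuity alone yields a measurable modification, so (a), (b) and (c) all hold.
  refine ⟨hsc, ?_, fun _ => hsc.hasMeasurableModification hI⟩
  tfae_have 1 → 2 := fun h => h.hasMeasurableVersion hC₀
  tfae_have 2 → 3 := fun _ => hmod.hasMeasurableBivariateLaws hC₀
  tfae_have 3 → 1 := fun _ => hmod
  tfae_finish
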